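/- A multigraph on a set $V$ is a function $w$ assigning to every unordered pair of distinct elements of $V$ a non-negative integer (its multiplicity). For integers $s\ge 2$ and $q\ge 0$, an $(s,q)$-graph is a multigraph in which $\sum_{\{x,y\}\subseteq X,\,x\neq y} w(xy)\le q$ for every set $X$ of exactly $s$ vertices. For $n\ge s$ let $\mathrm{ex}_\Pi(n,s,q)$ be the maximum of $\prod_{\{u,v\}\subseteq [n],\,u\neq v} w(uv)$ over all $(s,q)$-graphs $w$ on $[n]=\{1,\dots,n\}$, and let $$\mathrm{ex}_\Pi(s,q):=\lim_{n\to\infty}\mathrm{ex}_\Pi(n,s,q)^{1/\binom n2}.$$ Let $\mathrm{ex}(m,K_k)$ denote the maximum number of edges of a $K_k$-free simple graph on $m$ vertices. **Theorem.** Let $a,r\ge 2$ be integers. Then the limit defining $\mathrm{ex}_\Pi\bigl(2r,\,a\binom{2r}{2}+\mathrm{ex}(2r,K_{r+1})-1\bigr)$ exists and $$\mathrm{ex}_\Pi\Bigl(2r,\ a\tbinom{2r}{2}+\mathrm{ex}(2r,K_{r+1})-1\Bigr)=a^{\frac{1-x_\star}{r-1}}\,(a+1)^{\frac{r-2+x_\star}{r-1}},\qquad\text{where}\quad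 x_\star=\frac{\log\left(\frac{a+1}{a}\right)}{\log\left(\frac{(a+1)^r}{(a-1)^{r-1}a}\right)}.$$ -/

import Mathlib

open Filter Topology

namespace MubayiTerry

/-- A multigraph on `V`: a weight function on the unordered pairs of distinct vertices with values
in the non-negative integers. The weight is carried by `Sym2 V` and normalized to be `0` on the
diagonal, so that multigraphs correspond exactly to functions on the 2-element subsets of `V`. -/
@[ext]
structure Multigraph (V : Type*) where
  /-- the multiplicity of a pair -/
  w : Sym2 V → ℕ
  w_diag : ∀ v : V, w s(v, v) = 0

/-- The pairs of distinct elements of `X`. -/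
def pairs {V : Type*} [DecidableEq V] (X : Finset V) : Finset (Sym2 V) :=
  X.sym2.filter (fun e => ¬ e.IsDiag)

namespace Multigraph

variable {V : Type*} [DecidableEq V]

/-- The number of edges supported by `X`, counted with multiplicity. -/
def edgeSum (G : Multigraph V) (X : Finset V) : ℕ := ∑ e ∈ pairs X, G.w e

/-- The product `P(G)` of all the edge multiplicities of `G`. -/
def edgeProd [Fintype V] (G : Multigraph V) : ℕ := ∏ e ∈ pairs (Finset.univ : Finset V), G.w e

/-- Every `s`-set of vertices supports at most `q` edges, counted with multiplicity. -/
def IsSQ (G : Multigraph V) (s q : ℕ) : Prop :=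
  ∀ X : Finset V, X.card = s → G.edgeSum X ≤ q

end Multigraph

/-- The values `P(G)`, for `G` an `(s, q)`-graph on `n` vertices. -/
def prodValues (n s q : ℕ) : Set ℕ :=
  {p | ∃ G : Multigraph (Fin n), G.IsSQ s q ∧ G.edgeProd = p}

/-- The maximum of `P(G)` over all `(s, q)`-graphs `G` on `n` vertices. It is a genuine maximum as
soon as `2 ≤ s ≤ n`, by `isGreatest_exPi`; for `n < s` there is no restriction on `G`, and the value
there is irrelevant for the limit as `n → ∞`. -/
noncomputable def exPi (n s q : ℕ) : ℕ := sSup (prodValues n s q)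

theorem isGreatest_exPi {n s : ℕ} (q : ℕ) (hs : 2 ≤ s) (hn : s ≤ n) :
    IsGreatest (prodValues n s q) (exPi n s q) := by
  have hne : (prodValues n s q).Nonempty :=
    ⟨_, ⟨fun _ => 0, fun _ => rfl⟩, fun X _ => by simp [Multigraph.edgeSum], rfl⟩
  have hb : BddAbove (prodValues n s q) := by
    refine ⟨q ^ (pairs (Finset.univ : Finset (Fin n))).card, ?_⟩
    rintro p ⟨G, hG, rfl⟩
    refine Finset.prod_le_pow_card _ _ _ fun e he => ?_
    induction e using Sym2.ind with
    | _ u v =>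
      have huv : u ≠ v := by simpa [pairs] using he
      obtain ⟨X, hX, hc⟩ := Finset.exists_superset_card_eq (s := ({u, v} : Finset (Fin n))) (n := s)
        (by rw [Finset.card_pair huv]; exact hs) (by simpa using hn)
      refine le_trans ?_ (hG X hc)
      refine Finset.single_le_sum (f := G.w) (fun _ _ => Nat.zero_le _) ?_
      have hu : u ∈ X := hX (by simp)
      have hv : v ∈ X := hX (by simp)
      simp [pairs, Finset.mk_mem_sym2_iff, hu, hv, huv]
  exact ⟨Nat.sSup_mem hne hb, fun p hp => le_csSup hb hp⟩

/-- `L` is the value of `ex_Π(s, q)`: the limit of `ex_Π(n, s, q) ^ (1 / (n choose 2))` as `n → ∞`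
exists and equals `L`. -/
def IsExPi (s q : ℕ) (L : ℝ) : Prop :=
  Tendsto (fun n : ℕ => ((exPi n s q : ℕ) : ℝ) ^ (1 / ((n.choose 2 : ℕ) : ℝ))) atTop (𝓝 L)

/-- The Turán number: the maximum number of edges of a `K_k`-free graph on `n` vertices. -/
noncomputable def turanNumber (n k : ℕ) : ℕ :=
  SimpleGraph.extremalNumber n (⊤ : SimpleGraph (Fin k))

/-- The quantity `x⋆(r, 1)`, which depends on `a` as well. -/
noncomputable def xStar (a r : ℕ) : ℝ :=
  Real.log (((a : ℝ) + 1) / a) /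
    Real.log (((a : ℝ) + 1) ^ r / (((a : ℝ) - 1) ^ (r - 1) * a))

end MubayiTerry

namespace MubayiTerry

/-! Write the deficit of a pair as `a + 1` minus its multiplicity. The Turán graph on `2r` vertices
with `r` parts is the complement of a perfect matching, so the edge condition says that every
`2r`-set has total deficit at least `r + 1`. Let `m = lossTwo a / lossOne a` and `T = r - 1 + 1/m`;
the logarithm of the claimed limit is `log (a + 1) - lossOne a / T`.

Upper bound. If some pair has multiplicity zero the product vanishes. Otherwise `covered_of_sparse`
finds at most `2r + 1` vertices with non-negative weights of total at most `T` such that every other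
vertex loses at least `lossOne a` in weighted logarithm. Averaging over these vertices yields one
whose logarithmic degree to the remaining vertices is at most the density times their number
(`exists_logDegree_le`). Deleting it and inducting (`sum_log_le`) costs an error linear in `n`,
invisible after division by `n.choose 2`. The covering is found by contradiction. When no weighting
covers, uniform weights on small sets fail, so such sets extend cheaply (`Extendable`). This forces
non-negative deficits, a zero clique of size `r`, and then a Turán configuration on `2r - 1`
vertices: `r - 1` disjoint pairs of deficit one plus a single vertex. A natural weighting of it can
fail only by exposing a path of zero deficits on four vertices, whose own weighting can fail only by
exposing a five-cycle, which does cover.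

Lower bound. Take `r` classes, with multiplicity `a - 1` inside one, `a` inside the others and `a +
1` across. Class proportions inverse to the inner losses equalize the logarithmic degrees, and a
greedy assignment attains this average (`exists_classes`). The proportion of the exceptional class
is `xStar a r`. -/

open Finset

/-! ### Sums over the pairs of a finite set. -/

section PairSums

variable {V : Type*} [DecidableEq V]

theorem mk_mem_pairs {X : Finset V} {u v : V} : s(u, v) ∈ pairs X ↔ (u ∈ X ∧ v ∈ X) ∧ u ≠ v := by
  simp [pairs]

theorem sum_pairs_insert {M : Type*} [AddCommMonoid M] (g : Sym2 V → M) {X : Finset V} {v : V}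
    (hv : v ∉ X) :
    ∑ e ∈ pairs (insert v X), g e = ∑ e ∈ pairs X, g e + ∑ x ∈ X, g s(v, x) := by
  have hdisj : Disjoint (pairs X) (X.image fun x => s(v, x)) := by
    rw [Finset.disjoint_right]
    intro e he h
    obtain ⟨x, -, rfl⟩ := Finset.mem_image.1 he
    exact hv (mk_mem_pairs.1 h).1.1
  have hunion : pairs (insert v X) = pairs X ∪ X.image fun x => s(v, x) := by
    ext e
    induction e using Sym2.ind with
    | _ x y =>
      simp only [Finset.mem_union, mk_mem_pairs, Finset.mem_insert, Finset.mem_image,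
        Sym2.eq_iff]
      constructor
      · rintro ⟨⟨rfl | hx, rfl | hy⟩, hne⟩
        · exact absurd rfl hne
        · exact Or.inr ⟨y, hy, Or.inl ⟨rfl, rfl⟩⟩
        · exact Or.inr ⟨x, hx, Or.inr ⟨rfl, rfl⟩⟩
        · exact Or.inl ⟨⟨hx, hy⟩, hne⟩
      · rintro (⟨⟨hx, hy⟩, hne⟩ | ⟨z, hz, ⟨rfl, rfl⟩ | ⟨rfl, rfl⟩⟩)
        · exact ⟨⟨Or.inr hx, Or.inr hy⟩, hne⟩
        · exact ⟨⟨Or.inl rfl, Or.inr hz⟩, fun h => hv (h ▸ hz)⟩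
        · exact ⟨⟨Or.inr hz, Or.inl rfl⟩, fun h => hv (h ▸ hz)⟩
  rw [hunion, Finset.sum_union hdisj, Finset.sum_image]
  exact fun x _ y _ h => Sym2.congr_right.1 h

theorem card_pairs (X : Finset V) : (pairs X).card = X.card.choose 2 := by
  induction X using Finset.induction_on with
  | empty => rfl
  | insert v X hv ih =>
    have := sum_pairs_insert (fun _ => 1) hv
    simp only [Finset.sum_const, smul_eq_mul, mul_one] at this
    rw [this, ih, Finset.card_insert_of_notMem hv, Nat.choose_succ_succ' X.card 1,
      Nat.choose_one_right, add_comm]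

theorem sum_pairs_pair {M : Type*} [AddCommMonoid M] (g : Sym2 V → M) {u v : V} (h : u ≠ v) :
    ∑ e ∈ pairs {u, v}, g e = g s(u, v) := by
  rw [sum_pairs_insert g (by simpa using h)]
  have : pairs ({v} : Finset V) = ∅ := by
    rw [← Finset.card_eq_zero, card_pairs]; rfl
  simp [this]

theorem add_le_sum_of_nonneg {f : V → ℤ} {X : Finset V} (hf : ∀ x ∈ X, 0 ≤ f x) {x y : V}
    (hx : x ∈ X) (hy : y ∈ X) (hne : x ≠ y) : f x + f y ≤ ∑ z ∈ X, f z := by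
  rw [← Finset.sum_pair hne]
  exact Finset.sum_le_sum_of_subset_of_nonneg (by simp [Finset.insert_subset_iff, hx, hy])
    fun z hz _ => hf z hz

end PairSums

/-! ### Fractional coverings and what their absence implies. -/

section Covered

variable {V : Type*} [DecidableEq V]

/-- Some weighting of at most `N` vertices of `S`, of total weight at most `T`, puts weighted loss
at least `1` on each other vertex of `S`. -/
def Covered (θ : Sym2 V → ℝ) (S : Finset V) (N : ℕ) (T : ℝ) : Prop :=
  ∃ Y ⊆ S, Y.Nonempty ∧ Y.card ≤ N ∧ ∃ ν : V → ℝ, (∀ y ∈ Y, 0 ≤ ν y) ∧ ∑ y ∈ Y, ν y ≤ T ∧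
    ∀ v ∈ S, v ∉ Y → 1 ≤ ∑ y ∈ Y, ν y * θ s(v, y)

/-- All coverings used have this shape: a constant weight on a bulk set `X` and a few special
points. Weights add up where points coincide, so no distinctness is required. -/
theorem Covered.of_weights {θ : Sym2 V → ℝ} {S : Finset V} {N k : ℕ} {T c : ℝ} {X : Finset V}
    (p : Fin k → V) (s : Fin k → ℝ) (hX : X ⊆ S) (hp : ∀ i, p i ∈ S) (hc : 0 ≤ c)
    (hs : ∀ i, 0 ≤ s i) (hne : X.Nonempty ∨ 0 < k) (hN : X.card + k ≤ N)
    (hT : c * X.card + ∑ i, s i ≤ T)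
    (h : ∀ v ∈ S, v ∉ X → (∀ i, v ≠ p i) →
      1 ≤ c * ∑ x ∈ X, θ s(v, x) + ∑ i, s i * θ s(v, p i)) : Covered θ S N T := by
  have hsum (f : V → ℝ) : ∑ y ∈ X ∪ Finset.univ.image p,
      ((if y ∈ X then c else 0) + ∑ i, if y = p i then s i else 0) * f y =
      c * ∑ x ∈ X, f x + ∑ i, s i * f (p i) := by
    simp only [add_mul, Finset.sum_add_distrib, Finset.sum_mul, ite_mul, zero_mul]
    congr 1
    · rw [← Finset.sum_filter, Finset.mul_sum]
      congr 1
      ext y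
      simp only [Finset.mem_filter, Finset.mem_union]
      tauto
    · rw [Finset.sum_comm]
      refine Finset.sum_congr rfl fun i _ => ?_
      rw [Finset.sum_ite_eq' (X ∪ Finset.univ.image p) (p i) fun y => s i * f y, if_pos (by simp)]
  refine ⟨X ∪ Finset.univ.image p, Finset.union_subset hX ?_, ?_, ?_,
    fun y => (if y ∈ X then c else 0) + ∑ i, if y = p i then s i else 0, ?_, ?_, ?_⟩
  · intro y hy
    obtain ⟨i, -, rfl⟩ := Finset.mem_image.1 hy
    exact hp i
  · rcases hne with h | h
    · exact h.mono Finset.subset_union_left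
    · exact ⟨p ⟨0, h⟩, by simp⟩
  · refine (Finset.card_union_le _ _).trans (le_trans ?_ hN)
    have : (Finset.univ.image p).card ≤ k := by
      simpa using Finset.card_image_le (s := Finset.univ) (f := p)
    lia
  · intro y _
    refine add_nonneg (by split_ifs <;> simp [hc]) (Finset.sum_nonneg fun i _ => ?_)
    split_ifs <;> simp [hs]
  · have := hsum fun _ => 1
    simp only [mul_one, Finset.sum_const, nsmul_eq_mul] at this
    rw [this]
    exact hT
  · intro v hv hvY
    rw [hsum fun y => θ s(v, y)]
    simp only [Finset.mem_union, Finset.mem_image, Finset.mem_univ, true_and, not_or,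
      not_exists] at hvY
    exact h v hv hvY.1 fun i => Ne.symm (hvY.2 i)

/-- Otherwise the uniform weight `1 / c` on `X` would be a covering. -/
theorem exists_sum_le_of_not_covered {d : Sym2 V → ℤ} {θ : Sym2 V → ℝ} {S : Finset V} {N : ℕ}
    {T : ℝ} (hθ : ∀ e, (d e : ℝ) ≤ θ e) (hcov : ¬ Covered θ S N T) {X : Finset V} (hX : X ⊆ S)
    (hne : X.Nonempty) {c : ℕ} (hc : 0 < c) (hN : X.card ≤ N) (hT : (X.card : ℝ) ≤ c * T) :
    ∃ v ∈ S, v ∉ X ∧ ∑ x ∈ X, d s(v, x) < c := by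
  by_contra! h
  have hc' : (0 : ℝ) < c := by exact_mod_cast hc
  refine hcov (Covered.of_weights (c := 1 / (c : ℝ)) (k := 0) Fin.elim0 Fin.elim0 hX
    (fun i => i.elim0) (by positivity) (fun i => i.elim0) (Or.inl hne) (by simpa using hN) ?_ ?_)
  · simp only [Finset.univ_eq_empty, Finset.sum_empty, add_zero]
    rw [one_div, inv_mul_le_iff₀ hc']
    exact hT
  · intro v hv hvX _
    simp only [Finset.univ_eq_empty, Finset.sum_empty, add_zero]
    rw [one_div, le_inv_mul_iff₀ hc', mul_one]
    calc (c : ℝ) ≤ ((∑ x ∈ X, d s(v, x) : ℤ) : ℝ) := by exact_mod_cast h v hv hvX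
      _ ≤ _ := by
        push_cast
        exact Finset.sum_le_sum fun x _ => hθ _

end Covered

/-! ### Extending sets at low deficit; zero cliques. -/

section Rigid

variable {V : Type*} [DecidableEq V]

/-- All pairs of distinct vertices of `K` have deficit zero. -/
def ZeroClique (d : Sym2 V → ℤ) (K : Finset V) : Prop :=
  ∀ x ∈ K, ∀ y ∈ K, x ≠ y → d s(x, y) = 0

theorem ZeroClique.insert {d : Sym2 V → ℤ} {K : Finset V} (hK : ZeroClique d K) {v : V}
    (hv : ∀ x ∈ K, d s(v, x) = 0) : ZeroClique d (insert v K) := by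
  intro x hx y hy hne
  rcases Finset.mem_insert.1 hx with rfl | hx' <;> rcases Finset.mem_insert.1 hy with rfl | hy'
  · exact absurd rfl hne
  · exact hv y hy'
  · rw [Sym2.eq_swap]
    exact hv x hx'
  · exact hK x hx' y hy' hne

theorem ZeroClique.union {d : Sym2 V → ℤ} {K Z : Finset V} (hK : ZeroClique d K)
    (hZ : ZeroClique d Z) (h : ∀ x ∈ K, ∀ z ∈ Z, d s(z, x) = 0) : ZeroClique d (K ∪ Z) := by
  intro x hx y hy hne
  rcases Finset.mem_union.1 hx with hx' | hx' <;> rcases Finset.mem_union.1 hy with hy' | hy'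
  · exact hK x hx' y hy' hne
  · rw [Sym2.eq_swap]
    exact h x hx' y hy'
  · exact h y hy' x hx'
  · exact hZ x hx' y hy' hne

theorem ZeroClique.sum_pairs {d : Sym2 V → ℤ} {K : Finset V} (hK : ZeroClique d K) :
    ∑ e ∈ pairs K, d e = 0 := by
  refine Finset.sum_eq_zero fun e he => ?_
  induction e using Sym2.ind with
  | _ x y =>
    obtain ⟨⟨hx, hy⟩, hne⟩ := mk_mem_pairs.1 he
    exact hK x hx y hy hne

/-- The combinatorial consequences, for deficits `d`, of the fact that no uniform weighting of a
small set covers `S`. -/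
structure Extendable (d : Sym2 V → ℤ) (S : Finset V) (r : ℕ) : Prop where
  nonempty : S.Nonempty
  two_le : 2 ≤ r
  le_sum : ∀ X ⊆ S, X.card = 2 * r → (r : ℤ) + 1 ≤ ∑ e ∈ pairs X, d e
  small : ∀ X ⊆ S, X.Nonempty → X.card + 1 ≤ r → ∃ v ∈ S, v ∉ X ∧ ∑ x ∈ X, d s(v, x) ≤ 0
  medium : ∀ X ⊆ S, X.Nonempty → X.card + 2 ≤ 2 * r →
    ∃ v ∈ S, v ∉ X ∧ ∑ x ∈ X, d s(v, x) ≤ 1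
  large : ∀ X ⊆ S, X.card + 1 = 2 * r → ∃ v ∈ S, v ∉ X ∧ ∑ x ∈ X, d s(v, x) ≤ 2

/-- The three extension properties come from uniform weights `1`, `1/2` and `1/3`. The bound `r -
2/3 ≤ T` is what the last needs, since `(2r - 1)/3 ≤ r - 2/3`. -/
theorem Extendable.of_not_covered {d : Sym2 V → ℤ} {θ : Sym2 V → ℝ} {S : Finset V} {r : ℕ}
    {T : ℝ} (hθ : ∀ e, (d e : ℝ) ≤ θ e) (hcov : ¬ Covered θ S (2 * r + 1) T) (hS : S.Nonempty)
    (hr : 2 ≤ r) (hT : (r : ℝ) - 2 / 3 ≤ T)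
    (hsum : ∀ X ⊆ S, X.card = 2 * r → (r : ℤ) + 1 ≤ ∑ e ∈ pairs X, d e) : Extendable d S r where
  nonempty := hS
  two_le := hr
  le_sum := hsum
  small X hX hne hc := by
    have hc' : (X.card : ℝ) + 1 ≤ r := by exact_mod_cast hc
    obtain ⟨v, hv, hvX, h⟩ := exists_sum_le_of_not_covered hθ hcov hX hne (c := 1) one_pos
      (by lia) (by push_cast; linarith)
    exact ⟨v, hv, hvX, by lia⟩
  medium X hX hne hc := by
    have hc' : (X.card : ℝ) + 2 ≤ 2 * r := by exact_mod_cast hc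
    obtain ⟨v, hv, hvX, h⟩ := exists_sum_le_of_not_covered hθ hcov hX hne (c := 2) two_pos
      (by lia) (by push_cast; linarith)
    exact ⟨v, hv, hvX, by lia⟩
  large X hX hc := by
    have hc' : (X.card : ℝ) + 1 = 2 * r := by exact_mod_cast hc
    have hr' : (2 : ℝ) ≤ r := by exact_mod_cast hr
    obtain ⟨v, hv, hvX, h⟩ := exists_sum_le_of_not_covered hθ hcov hX
      (Finset.card_pos.1 (by lia)) (c := 3) three_pos (by lia) (by push_cast; linarith)
    exact ⟨v, hv, hvX, by lia⟩

variable {d : Sym2 V → ℤ} {S : Finset V} {r : ℕ}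

/-- Grow `X` to a `2r`-set, whose deficit is at least `r + 1`: each added vertex contributes at most
one, except the last, which contributes at most two. -/
theorem Extendable.card_sub_le_sum (h : Extendable d S r) {X : Finset V} (hX : X ⊆ S)
    (h1 : r ≤ X.card) (h2 : X.card + 1 ≤ 2 * r) : (X.card : ℤ) - r ≤ ∑ e ∈ pairs X, d e := by
  obtain ⟨j, hj⟩ := Nat.exists_eq_add_of_le h2
  have hr := h.two_le
  induction j generalizing X with
  | zero =>
    obtain ⟨v, hv, hvX, hle⟩ := h.large X hX (by lia)
    have := h.le_sum (insert v X) (Finset.insert_subset hv hX)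
      (by rw [Finset.card_insert_of_notMem hvX]; lia)
    rw [sum_pairs_insert d hvX] at this
    lia
  | succ j ih =>
    obtain ⟨v, hv, hvX, hle⟩ := h.medium X hX (Finset.card_pos.1 (by lia)) (by lia)
    have hcard := Finset.card_insert_of_notMem hvX
    have := ih (Finset.insert_subset hv hX) (by lia) (by lia) (by lia)
    rw [sum_pairs_insert d hvX] at this
    lia

theorem Extendable.sum_nonneg (h : Extendable d S r) {X : Finset V} (hX : X ⊆ S)
    (hne : X.Nonempty) (hc : X.card ≤ r) : 0 ≤ ∑ e ∈ pairs X, d e := by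
  obtain ⟨j, hj⟩ := Nat.exists_eq_add_of_le hc
  have hr := h.two_le
  induction j generalizing X with
  | zero =>
    have := h.card_sub_le_sum hX (by lia) (by lia)
    lia
  | succ j ih =>
    obtain ⟨v, hv, hvX, hle⟩ := h.small X hX hne (by lia)
    have hcard := Finset.card_insert_of_notMem hvX
    have := ih (Finset.insert_subset hv hX) (by simp) (by lia) (by lia)
    rw [sum_pairs_insert d hvX] at this
    lia

theorem Extendable.nonneg (h : Extendable d S r) {u v : V} (hu : u ∈ S) (hv : v ∈ S)
    (hne : u ≠ v) : 0 ≤ d s(u, v) := by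
  rw [← sum_pairs_pair d hne]
  exact h.sum_nonneg (by simp [Finset.insert_subset_iff, hu, hv]) (by simp)
    (by rw [Finset.card_pair hne]; exact h.two_le)

theorem Extendable.nonneg_of_notMem (h : Extendable d S r) {X : Finset V} (hX : X ⊆ S) {v : V}
    (hv : v ∈ S) (hvX : v ∉ X) : ∀ x ∈ X, 0 ≤ d s(v, x) := fun _ hx =>
  h.nonneg hv (hX hx) fun hne => hvX (hne ▸ hx)

/-- A set of `r + 1` vertices has total deficit at least one, so a zero clique cannot have that
size. -/
theorem Extendable.exists_pos_of_clique (h : Extendable d S r) {K : Finset V} (hK : K ⊆ S)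
    (hclique : ZeroClique d K) (hc : K.card = r) {v : V} (hv : v ∈ S) (hvK : v ∉ K) :
    ∃ x ∈ K, 1 ≤ d s(v, x) := by
  by_contra! hcon
  have hr := h.two_le
  have h0 : ∀ x ∈ K, d s(v, x) = 0 := fun x hx => by
    have := h.nonneg_of_notMem hK hv hvK x hx
    have := hcon x hx
    lia
  have hcard := Finset.card_insert_of_notMem hvK
  have := h.card_sub_le_sum (Finset.insert_subset hv hK) (by lia) (by lia)
  rw [(hclique.insert h0).sum_pairs] at this
  lia

theorem Extendable.exists_clique (h : Extendable d S r) :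
    ∃ K ⊆ S, ZeroClique d K ∧ K.card = r := by
  have key : ∀ t, 1 ≤ t → t ≤ r → ∃ K ⊆ S, ZeroClique d K ∧ K.card = t := by
    intro t ht
    induction t, ht using Nat.le_induction with
    | base =>
      intro _
      obtain ⟨v, hv⟩ := h.nonempty
      refine ⟨{v}, by simpa using hv, ?_, by simp⟩
      intro x hx y hy hne
      simp only [Finset.mem_singleton] at hx hy
      exact absurd (hx.trans hy.symm) hne
    | succ t ht ih =>
      intro htr
      obtain ⟨K, hK, hcl, hc⟩ := ih (by lia)
      obtain ⟨v, hv, hvK, hle⟩ := h.small K hK (Finset.card_pos.1 (by lia)) (by lia)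
      have hnn := h.nonneg_of_notMem hK hv hvK
      have h0 := (Finset.sum_eq_zero_iff_of_nonneg hnn).1
        (le_antisymm hle (Finset.sum_nonneg hnn))
      exact ⟨insert v K, Finset.insert_subset hv hK, hcl.insert h0,
        by rw [Finset.card_insert_of_notMem hvK, hc]⟩
  exact key r (by have := h.two_le; lia) le_rfl

end Rigid

/-! ### Growing a Turán configuration. -/

section Matched

variable {V : Type*} [DecidableEq V]

/-- `R` consists of `k` disjoint pairs of deficit one, all other deficits in `R` being zero. -/
inductive Matched (d : Sym2 V → ℤ) : ℕ → Finset V → Prop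
  | empty : Matched d 0 ∅
  | step {k : ℕ} {R : Finset V} {x y : V} : Matched d k R → x ∉ R → y ∉ R → x ≠ y →
      d s(x, y) = 1 → (∀ z ∈ R, d s(x, z) = 0) → (∀ z ∈ R, d s(y, z) = 0) →
      Matched d (k + 1) (insert x (insert y R))

variable {d : Sym2 V → ℤ} {S : Finset V} {r k : ℕ} {R : Finset V}

theorem Matched.card (h : Matched d k R) : R.card = 2 * k := by
  induction h with
  | empty => rfl
  | step _ hx hy hne _ _ _ ih =>
    rw [Finset.card_insert_of_notMem (by simp [hne, hx]), Finset.card_insert_of_notMem hy, ih]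
    ring

theorem Matched.sum_pairs (h : Matched d k R) : ∑ e ∈ pairs R, d e = k := by
  induction h with
  | empty => rfl
  | step _ hx hy hne hxy hx0 hy0 ih =>
    rw [sum_pairs_insert d (by simp [hne, hx]), sum_pairs_insert d hy, ih,
      Finset.sum_insert hy, hxy, Finset.sum_eq_zero hx0, Finset.sum_eq_zero hy0]
    push_cast
    ring

/-- A transversal of the pairs is a zero clique, and it can be chosen to avoid any given vertex. -/
theorem Matched.exists_clique (h : Matched d k R) (u : V) :
    ∃ K ⊆ R, u ∉ K ∧ ZeroClique d K ∧ K.card = k := by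
  induction h with
  | empty => exact ⟨∅, by simp, by simp, by simp [ZeroClique], rfl⟩
  | @step k R x y _ hx hy hne hxy hx0 hy0 ih =>
    obtain ⟨K, hK, huK, hcl, hc⟩ := ih
    by_cases hux : u = x
    · refine ⟨insert y K, Finset.insert_subset (by simp) fun z hz => by simp [hK hz], ?_,
        hcl.insert fun z hz => hy0 z (hK hz), ?_⟩
      · simp only [Finset.mem_insert, not_or]
        exact ⟨hux ▸ hne, huK⟩
      · rw [Finset.card_insert_of_notMem fun h => hy (hK h), hc]
    · refine ⟨insert x K, Finset.insert_subset (by simp) fun z hz => by simp [hK hz], ?_,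
        hcl.insert fun z hz => hx0 z (hK hz), ?_⟩
      · simp only [Finset.mem_insert, not_or]
        exact ⟨hux, huK⟩
      · rw [Finset.card_insert_of_notMem fun h => hx (hK h), hc]

/-- The order of the pairs is immaterial, so the pair containing `u` may be taken as the last one
added. -/
theorem Matched.exists_pair (h : Matched d k R) {u : V} (hu : u ∈ R) :
    ∃ (j : ℕ) (y : V) (R' : Finset V), k = j + 1 ∧ R = insert u (insert y R') ∧ Matched d j R' ∧
      u ∉ R' ∧ y ∉ R' ∧ u ≠ y ∧ d s(u, y) = 1 ∧ (∀ z ∈ R', d s(u, z) = 0) ∧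
      ∀ z ∈ R', d s(y, z) = 0 := by
  induction h with
  | empty => simp at hu
  | @step k R x y hR hx hy hne hxy hx0 hy0 ih =>
    rcases Finset.mem_insert.1 hu with rfl | hu
    · exact ⟨k, y, R, rfl, rfl, hR, hx, hy, hne, hxy, hx0, hy0⟩
    rcases Finset.mem_insert.1 hu with rfl | hu
    · exact ⟨k, x, R, rfl, Finset.insert_comm _ _ _, hR, hy, hx, hne.symm,
        by rw [Sym2.eq_swap]; exact hxy, hy0, hx0⟩
    obtain ⟨j, y', R', rfl, rfl, hR', hu', hy', hne', huy', hu0', hy0'⟩ := ih hu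
    simp only [Finset.mem_insert, not_or, forall_eq_or_imp] at hx hy hx0 hy0
    refine ⟨j + 1, y', insert x (insert y R'), rfl, ?_, hR'.step hx.2.2 hy.2.2 hne hxy
      hx0.2.2 hy0.2.2, ?_, ?_, hne', huy', ?_, ?_⟩
    · ext z
      simp only [Finset.mem_insert]
      tauto
    · simp only [Finset.mem_insert, not_or]
      exact ⟨Ne.symm hx.1, Ne.symm hy.1, hu'⟩
    · simp only [Finset.mem_insert, not_or]
      exact ⟨Ne.symm hx.2.1, Ne.symm hy.2.1, hy'⟩
    · simp only [Finset.mem_insert, forall_eq_or_imp]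
      exact ⟨Sym2.eq_swap (a := x) ▸ hx0.1, Sym2.eq_swap (a := y) ▸ hy0.1, hu0'⟩
    · simp only [Finset.mem_insert, forall_eq_or_imp]
      exact ⟨Sym2.eq_swap (a := x) ▸ hx0.2.1, Sym2.eq_swap (a := y) ▸ hy0.2.1, hy0'⟩

/-- A vertex outside a Turán configuration of `2 * r - 1` vertices has total deficit at least two
to it. -/
theorem Extendable.two_le_of_matched (h : Extendable d S r) (hR : Matched d k R) (hk : k + 1 = r)
    (hRS : R ⊆ S) {z w : V} (hz : z ∈ S) (hzR : z ∉ R) (hz0 : ∀ x ∈ R, d s(z, x) = 0)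
    (hw : w ∈ S) (hwR : w ∉ R) (hwz : w ≠ z) : 2 ≤ d s(w, z) + ∑ x ∈ R, d s(w, x) := by
  have hwzR : w ∉ insert z R := by simp [hwz, hwR]
  have := h.le_sum (insert w (insert z R))
    (Finset.insert_subset hw (Finset.insert_subset hz hRS))
    (by rw [Finset.card_insert_of_notMem hwzR, Finset.card_insert_of_notMem hzR, hR.card]; lia)
  rw [sum_pairs_insert d hwzR, sum_pairs_insert d hzR, hR.sum_pairs, Finset.sum_eq_zero hz0,
    Finset.sum_insert hzR] at this
  lia

/-- Adding the pair `x`, `y` to `R` gives a Turán configuration with `z` as its single vertex. -/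
theorem Extendable.two_le_of_path (h : Extendable d S r) (hR : Matched d k R) (hk : k + 2 = r)
    (hRS : R ⊆ S) {x y z w : V} (hx : x ∈ S) (hy : y ∈ S) (hz : z ∈ S) (hxR : x ∉ R) (hyR : y ∉ R)
    (hzR : z ∉ R) (hx0 : ∀ u ∈ R, d s(x, u) = 0) (hy0 : ∀ u ∈ R, d s(y, u) = 0)
    (hz0 : ∀ u ∈ R, d s(z, u) = 0) (hxz : x ≠ z) (hyz : y ≠ z) (hxy : x ≠ y)
    (dxz : d s(x, z) = 0) (dzy : d s(z, y) = 0) (dxy : d s(x, y) = 1)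
    (hw : w ∈ S) (hwR : w ∉ R) (hwx : w ≠ x) (hwy : w ≠ y) (hwz : w ≠ z) :
    2 ≤ d s(w, x) + d s(w, z) + d s(w, y) + ∑ u ∈ R, d s(w, u) := by
  have := h.two_le_of_matched (hR.step hxR hyR hxy dxy hx0 hy0) (by lia)
    (Finset.insert_subset hx (Finset.insert_subset hy hRS)) hz
    (by simp [Ne.symm hxz, Ne.symm hyz, hzR])
    (by
      simp only [Finset.mem_insert, forall_eq_or_imp]
      exact ⟨by rw [Sym2.eq_swap]; exact dxz, dzy, hz0⟩) hw (by simp [hwx, hwy, hwR]) hwz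
  rw [Finset.sum_insert (by simp [hxy, hxR]), Finset.sum_insert hyR] at this
  lia

/-- Begin with a zero clique `Z` of size `r` and repeatedly give one of its vertices a partner. A
new vertex `v` of total deficit at most one to `R ∪ Z` must have positive deficit to every clique
formed by `Z` and a transversal of `R`, so its unique non-zero partner lies in `Z`. -/
theorem Extendable.exists_matched (h : Extendable d S r) : ∀ k, k + 1 ≤ r →
    ∃ R Z : Finset V, Matched d k R ∧ R ⊆ S ∧ Z ⊆ S ∧ Disjoint R Z ∧ ZeroClique d Z ∧
      Z.card + k = r ∧ ∀ x ∈ R, ∀ z ∈ Z, d s(z, x) = 0 := by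
  intro k
  induction k with
  | zero =>
    intro _
    obtain ⟨K, hK, hcl, hc⟩ := h.exists_clique
    exact ⟨∅, K, .empty, by simp, hK, by simp, hcl, by simpa using hc, by simp⟩
  | succ k ih =>
    intro hk
    obtain ⟨R, Z, hR, hRS, hZS, hdisj, hcl, hc, h0⟩ := ih (by lia)
    have hXS : R ∪ Z ⊆ S := Finset.union_subset hRS hZS
    have hXc : (R ∪ Z).card = R.card + Z.card := Finset.card_union_of_disjoint hdisj
    rw [hR.card] at hXc
    obtain ⟨v, hv, hvX, hle⟩ := h.medium (R ∪ Z) hXS (Finset.card_pos.1 (by lia)) (by lia)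
    have hnn := h.nonneg_of_notMem hXS hv hvX
    have huniq : ∀ x ∈ R ∪ Z, ∀ y ∈ R ∪ Z, 1 ≤ d s(v, x) → 1 ≤ d s(v, y) → x = y := by
      intro x hx y hy h1 h2
      by_contra hne
      have := add_le_sum_of_nonneg hnn hx hy hne
      lia
    have hpos : ∀ u, ∃ x ∈ R ∪ Z, x ∉ R.filter (· = u) ∧ 1 ≤ d s(v, x) := by
      intro u
      obtain ⟨K, hK, huK, hKcl, hKc⟩ := hR.exists_clique u
      have hKZ : K ∪ Z ⊆ R ∪ Z := Finset.union_subset_union_left hK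
      obtain ⟨x, hx, h1⟩ := h.exists_pos_of_clique (hKZ.trans hXS)
        (hKcl.union hcl fun y hy => h0 y (hK hy))
        (by rw [Finset.card_union_of_disjoint (hdisj.mono_left hK)]; lia) hv
        fun hvK => hvX (hKZ hvK)
      refine ⟨x, hKZ hx, ?_, h1⟩
      simp only [Finset.mem_filter, not_and]
      rintro hxR rfl
      rcases Finset.mem_union.1 hx with hx | hx
      · exact huK hx
      · exact Finset.disjoint_left.1 hdisj hxR hx
    -- Applying `hpos` again with `u = x` avoids `x` if it lies in `R`; uniqueness then forces `x ∉
    -- R`.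
    obtain ⟨x, hx, -, hx1⟩ := hpos v
    obtain ⟨z, hz, hzx, hz1⟩ := hpos x
    obtain rfl := huniq x hx z hz hx1 hz1
    have hzR : x ∉ R := fun hxR => hzx (by simp [hxR])
    have hzZ : x ∈ Z := (Finset.mem_union.1 hx).resolve_left hzR
    have hz1' : d s(x, v) = 1 := by
      have := Finset.single_le_sum hnn hx
      rw [Sym2.eq_swap]
      lia
    have hv0 : ∀ y ∈ R ∪ Z, y ≠ x → d s(v, y) = 0 := by
      intro y hy hne
      have := hnn y hy
      by_contra hne0
      exact hne (huniq y hy x hx (by lia) hx1)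
    have hvR : v ∉ R := fun h => hvX (by simp [h])
    have hvZ : v ∉ Z := fun h => hvX (by simp [h])
    have hxv : x ≠ v := fun h => hvZ (h ▸ hzZ)
    refine ⟨insert x (insert v R), Z.erase x, hR.step hzR hvR hxv hz1' (fun y hy => h0 y hy x hzZ)
      (fun y hy => hv0 y (by simp [hy]) fun h => hzR (h ▸ hy)),
      Finset.insert_subset (hZS hzZ) (Finset.insert_subset hv hRS),
      (Finset.erase_subset _ _).trans hZS, ?_, ?_, ?_, ?_⟩
    · rw [Finset.disjoint_left] at hdisj ⊢
      intro y hy hyZ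
      rcases Finset.mem_insert.1 hy with rfl | hy
      · simp at hyZ
      rcases Finset.mem_insert.1 hy with rfl | hy
      · exact hvZ (Finset.mem_of_mem_erase hyZ)
      · exact hdisj hy (Finset.mem_of_mem_erase hyZ)
    · exact fun y hy z hz => hcl y (Finset.mem_of_mem_erase hy) z (Finset.mem_of_mem_erase hz)
    · rw [Finset.card_erase_of_mem hzZ]
      have := Finset.card_pos.2 ⟨x, hzZ⟩
      lia
    · intro y hy z hz
      obtain ⟨hzx, hzZ'⟩ := Finset.mem_erase.1 hz
      rcases Finset.mem_insert.1 hy with rfl | hy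
      · exact hcl z hzZ' y hzZ hzx
      rcases Finset.mem_insert.1 hy with rfl | hy
      · rw [Sym2.eq_swap]
        exact hv0 z (by simp [hzZ']) hzx
      · exact h0 y hy z hzZ'

end Matched

/-! ### The three weightings: Turán configuration, four-vertex path, five-cycle. -/

section Cases

variable {V : Type*} [DecidableEq V] {d : Sym2 V → ℤ} {θ : Sym2 V → ℝ} {S R : Finset V} {r k : ℕ}

/-- Weight `1/2` on `R` and `1/4` on the cycle has total `(r - 2) + 5/4 = r - 3/4`, on exactly `2r +
1` vertices. -/
theorem Extendable.covered_of_cycle (h : Extendable d S r) (hθ : ∀ e, (d e : ℝ) ≤ θ e) {T : ℝ}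
    (hT : (r : ℝ) - 3 / 4 ≤ T) (hR : Matched d k R) (hk : k + 2 = r) (hRS : R ⊆ S)
    {p₁ p₂ p₃ p₄ p₅ : V} (h₁ : p₁ ∈ S) (h₂ : p₂ ∈ S) (h₃ : p₃ ∈ S) (h₄ : p₄ ∈ S) (h₅ : p₅ ∈ S)
    (hR₁ : p₁ ∉ R) (hR₂ : p₂ ∉ R) (hR₃ : p₃ ∉ R) (hR₄ : p₄ ∉ R) (hR₅ : p₅ ∉ R)
    (z₁ : ∀ u ∈ R, d s(p₁, u) = 0) (z₂ : ∀ u ∈ R, d s(p₂, u) = 0) (z₃ : ∀ u ∈ R, d s(p₃, u) = 0)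
    (z₄ : ∀ u ∈ R, d s(p₄, u) = 0) (z₅ : ∀ u ∈ R, d s(p₅, u) = 0)
    (n₁₂ : p₁ ≠ p₂) (n₂₃ : p₂ ≠ p₃) (n₃₄ : p₃ ≠ p₄) (n₄₅ : p₄ ≠ p₅) (n₅₁ : p₅ ≠ p₁)
    (n₁₃ : p₁ ≠ p₃) (n₂₄ : p₂ ≠ p₄) (n₃₅ : p₃ ≠ p₅) (n₄₁ : p₄ ≠ p₁) (n₅₂ : p₅ ≠ p₂)
    (d₁₂ : d s(p₁, p₂) = 0) (d₂₃ : d s(p₂, p₃) = 0) (d₃₄ : d s(p₃, p₄) = 0)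
    (d₄₅ : d s(p₄, p₅) = 0) (d₅₁ : d s(p₅, p₁) = 0) (d₁₃ : d s(p₁, p₃) = 1)
    (d₂₄ : d s(p₂, p₄) = 1) (d₃₅ : d s(p₃, p₅) = 1) (d₄₁ : d s(p₄, p₁) = 1)
    (d₅₂ : d s(p₅, p₂) = 1) : Covered θ S (2 * r + 1) T := by
  refine Covered.of_weights (c := 1 / 2) (k := 5) ![p₁, p₂, p₃, p₄, p₅] (fun _ => 1 / 4) hRS ?_
    (by norm_num) (fun _ => by norm_num) (Or.inr (by norm_num)) (by rw [hR.card]; lia) ?_ ?_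
  · intro i
    fin_cases i <;> assumption
  · have hk' : (k : ℝ) + 2 = r := by exact_mod_cast hk
    rw [hR.card]
    simp only [Finset.sum_const, Finset.card_univ, Fintype.card_fin, nsmul_eq_mul]
    push_cast
    linarith
  · intro w hw hwR hwp
    have w₁ : w ≠ p₁ := hwp 0
    have w₂ : w ≠ p₂ := hwp 1
    have w₃ : w ≠ p₃ := hwp 2
    have w₄ : w ≠ p₄ := hwp 3
    have w₅ : w ≠ p₅ := hwp 4
    have t₁ := h.two_le_of_path hR hk hRS h₁ h₃ h₂ hR₁ hR₃ hR₂ z₁ z₃ z₂ n₁₂ n₂₃.symm n₁₃ d₁₂ d₂₃ d₁₃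
      hw hwR w₁ w₃ w₂
    have t₂ := h.two_le_of_path hR hk hRS h₂ h₄ h₃ hR₂ hR₄ hR₃ z₂ z₄ z₃ n₂₃ n₃₄.symm n₂₄ d₂₃ d₃₄ d₂₄
      hw hwR w₂ w₄ w₃
    have t₃ := h.two_le_of_path hR hk hRS h₃ h₅ h₄ hR₃ hR₅ hR₄ z₃ z₅ z₄ n₃₄ n₄₅.symm n₃₅ d₃₄ d₄₅ d₃₅
      hw hwR w₃ w₅ w₄
    have t₄ := h.two_le_of_path hR hk hRS h₄ h₁ h₅ hR₄ hR₁ hR₅ z₄ z₁ z₅ n₄₅ n₅₁.symm n₄₁ d₄₅ d₅₁ d₄₁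
      hw hwR w₄ w₁ w₅
    have t₅ := h.two_le_of_path hR hk hRS h₅ h₂ h₁ hR₅ hR₂ hR₁ z₅ z₂ z₁ n₅₁ n₁₂.symm n₅₂ d₅₁ d₁₂ d₅₂
      hw hwR w₅ w₂ w₁
    have e0 : 0 ≤ ∑ u ∈ R, d s(w, u) := Finset.sum_nonneg (h.nonneg_of_notMem hRS hw hwR)
    have q₁ := h.nonneg hw h₁ w₁
    have q₂ := h.nonneg hw h₂ w₂
    have q₃ := h.nonneg hw h₃ w₃
    have q₄ := h.nonneg hw h₄ w₄
    have q₅ := h.nonneg hw h₅ w₅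
    -- Let `e` be the deficit to `R` and `Q` that to the cycle. Adding `t₁` to `t₅` gives `3Q + 5e ≥
    -- 10`; integrality then yields `Q ≥ 4` if `e = 0` and `Q ≥ 2` if `e = 1`.
    have key : 4 ≤ 2 * ∑ u ∈ R, d s(w, u) +
        (d s(w, p₁) + d s(w, p₂) + d s(w, p₃) + d s(w, p₄) + d s(w, p₅)) := by lia
    have key' : (4 : ℝ) ≤ 2 * ∑ u ∈ R, (d s(w, u) : ℝ) +
        (d s(w, p₁) + d s(w, p₂) + d s(w, p₃) + d s(w, p₄) + d s(w, p₅)) := by exact_mod_cast key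
    have hRθ : ∑ u ∈ R, (d s(w, u) : ℝ) ≤ ∑ u ∈ R, θ s(w, u) :=
      Finset.sum_le_sum fun u _ => hθ _
    have g₁ := hθ s(w, p₁)
    have g₂ := hθ s(w, p₂)
    have g₃ := hθ s(w, p₃)
    have g₄ := hθ s(w, p₄)
    have g₅ := hθ s(w, p₅)
    simp [Fin.sum_univ_succ, -one_div]
    linarith

/-- The numerical inequality behind the weighting of a zero path on four vertices. -/
theorem one_le_path_weight {m Θ θ₁ θ₂ θ₃ θ₄ : ℝ} {e q₁ q₂ q₃ q₄ : ℤ} (hm2 : 2 ≤ m) (hm3 : m ≤ 3)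
    (he : 0 ≤ e) (h₁ : 0 ≤ q₁) (h₂ : 0 ≤ q₂) (h₃ : 0 ≤ q₃) (h₄ : 0 ≤ q₄)
    (hΘ : (e : ℝ) ≤ Θ) (g₁ : (q₁ : ℝ) ≤ θ₁) (g₂ : (q₂ : ℝ) ≤ θ₂) (g₃ : (q₃ : ℝ) ≤ θ₃)
    (g₄ : (q₄ : ℝ) ≤ θ₄) (f₂ : 2 ≤ q₂ → m ≤ θ₂) (f₃ : 2 ≤ q₃ → m ≤ θ₃)
    (t₁ : 2 ≤ q₁ + q₂ + q₃ + e) (t₂ : 2 ≤ q₂ + q₃ + q₄ + e)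
    (hpath : ¬ (e = 1 ∧ q₁ = 0 ∧ q₄ = 0 ∧ q₂ + q₃ = 1))
    (hcycle : ¬ (e = 0 ∧ q₁ = 0 ∧ q₄ = 0 ∧ q₂ = 1 ∧ q₃ = 1)) :
    1 ≤ 1 / 2 * Θ + ((1 - 1 / m) / 2 * θ₁ + 1 / m * θ₂ + 1 / m * θ₃ + (1 - 1 / m) / 2 * θ₄) := by
  obtain ⟨t, ht⟩ : ∃ t, t = 1 / m := ⟨_, rfl⟩
  have htm : t * m = 1 := by rw [ht]; field_simp
  have ht1 : 1 / 3 ≤ t := by nlinarith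
  have ht2 : t ≤ 1 / 2 := by nlinarith
  rw [← ht]
  have lower {s θ : ℝ} {q : ℤ} (hs : 0 ≤ s) (hq : (q : ℝ) ≤ θ) {b : ℤ} (hb : b ≤ q) :
      s * b ≤ s * θ :=
    mul_le_mul_of_nonneg_left (le_trans (by exact_mod_cast hb) hq) hs
  have hs0 : (0 : ℝ) ≤ (1 - t) / 2 := by linarith
  have ht0 : (0 : ℝ) ≤ t := by linarith
  have a₁ := lower hs0 g₁ h₁
  have a₂ := lower ht0 g₂ h₂
  have a₃ := lower ht0 g₃ h₃
  have a₄ := lower hs0 g₄ h₄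
  have aΘ : (0 : ℝ) ≤ Θ := le_trans (by exact_mod_cast he) hΘ
  push_cast at a₁ a₂ a₃ a₄
  by_cases c₂ : 2 ≤ q₂
  · have := mul_le_mul_of_nonneg_left (f₂ c₂) ht0
    linarith
  by_cases c₃ : 2 ≤ q₃
  · have := mul_le_mul_of_nonneg_left (f₃ c₃) ht0
    linarith
  by_cases ce : 2 ≤ e
  · have : (2 : ℝ) ≤ e := by exact_mod_cast ce
    linarith
  have b₁ := lower hs0 g₁ (b := 2 - q₂ - q₃ - e) (by lia)
  have b₄ := lower hs0 g₄ (b := 2 - q₂ - q₃ - e) (by lia)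
  have b₂ := lower ht0 g₂ le_rfl
  have b₃ := lower ht0 g₃ le_rfl
  have hor : q₁ = 0 ∧ q₄ = 0 ∨ 1 ≤ q₁ ∨ 1 ≤ q₄ := by lia
  push_cast at b₁ b₄
  have hq₂ : q₂ = 0 ∨ q₂ = 1 := by lia
  have hq₃ : q₃ = 0 ∨ q₃ = 1 := by lia
  have he' : e = 0 ∨ e = 1 := by lia
  -- The case `e = 0`, `q₂ = q₃ = 1` with one end positive gives only `(1 + 3t)/2`; it uses `t ≥
  -- 1/3`, that is `m ≤ 3`.
  rcases hor with hor | hor | hor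
  · rcases hq₂ with rfl | rfl <;> rcases hq₃ with rfl | rfl <;> rcases he' with rfl | rfl <;>
      first
      | (exfalso; lia)
      | (push_cast at *; linarith)
  all_goals
    have c := lower hs0 (by assumption) hor
    rcases hq₂ with rfl | rfl <;> rcases hq₃ with rfl | rfl <;> rcases he' with rfl | rfl <;>
    push_cast at * <;> linarith

/-- Weight `1/2` on `R`, `1/m` on the two inner vertices and `(1 - 1/m)/2` on the ends. A vertex
escaping this weighting either extends a zero clique of size `r` or closes the path to a five-cycle.
-/
theorem Extendable.covered_of_path (h : Extendable d S r) (hθ : ∀ e, (d e : ℝ) ≤ θ e) {m : ℝ}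
    (hθ2 : ∀ e, 2 ≤ d e → m ≤ θ e) (hm2 : 2 ≤ m) (hm3 : m ≤ 3)
    (hR : Matched d k R) (hk : k + 2 = r) (hRS : R ⊆ S)
    {p₁ p₂ p₃ p₄ : V} (h₁ : p₁ ∈ S) (h₂ : p₂ ∈ S) (h₃ : p₃ ∈ S) (h₄ : p₄ ∈ S)
    (hR₁ : p₁ ∉ R) (hR₂ : p₂ ∉ R) (hR₃ : p₃ ∉ R) (hR₄ : p₄ ∉ R)
    (z₁ : ∀ u ∈ R, d s(p₁, u) = 0) (z₂ : ∀ u ∈ R, d s(p₂, u) = 0) (z₃ : ∀ u ∈ R, d s(p₃, u) = 0)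
    (z₄ : ∀ u ∈ R, d s(p₄, u) = 0)
    (n₁₂ : p₁ ≠ p₂) (n₂₃ : p₂ ≠ p₃) (n₃₄ : p₃ ≠ p₄) (n₁₃ : p₁ ≠ p₃) (n₂₄ : p₂ ≠ p₄) (n₁₄ : p₁ ≠ p₄)
    (d₁₂ : d s(p₁, p₂) = 0) (d₂₃ : d s(p₂, p₃) = 0) (d₃₄ : d s(p₃, p₄) = 0)
    (d₁₃ : d s(p₁, p₃) = 1) (d₂₄ : d s(p₂, p₄) = 1) (d₁₄ : d s(p₁, p₄) = 1) :
    Covered θ S (2 * r + 1) ((r : ℝ) - 1 + 1 / m) := by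
  have hm0 : 0 < m := by linarith
  have hinv : 1 / m ≤ 1 / 2 := one_div_le_one_div_of_le two_pos hm2
  have hinv' : 1 / 3 ≤ 1 / m := one_div_le_one_div_of_le hm0 hm3
  have hk' : (k : ℝ) + 2 = r := by exact_mod_cast hk
  by_contra hcov
  refine hcov (Covered.of_weights (c := 1 / 2) (k := 4) ![p₁, p₂, p₃, p₄]
    ![(1 - 1 / m) / 2, 1 / m, 1 / m, (1 - 1 / m) / 2] hRS ?_
    (by norm_num) ?_ (Or.inr (by norm_num)) (by rw [hR.card]; lia) ?_ ?_)
  · intro i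
    fin_cases i <;> assumption
  · have : 0 ≤ (1 - 1 / m) / 2 := by linarith
    have : 0 ≤ 1 / m := by linarith
    intro i
    fin_cases i <;> assumption
  · rw [hR.card]
    simp only [Fin.sum_univ_succ, Finset.univ_eq_empty, Finset.sum_empty, Matrix.cons_val_zero,
      Matrix.cons_val_succ]
    push_cast
    linarith
  intro w hw hwR hwp
  have w₁ : w ≠ p₁ := hwp 0
  have w₂ : w ≠ p₂ := hwp 1
  have w₃ : w ≠ p₃ := hwp 2
  have w₄ : w ≠ p₄ := hwp 3
  have t₁ := h.two_le_of_path hR hk hRS h₁ h₃ h₂ hR₁ hR₃ hR₂ z₁ z₃ z₂ n₁₂ n₂₃.symm n₁₃ d₁₂ d₂₃ d₁₃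
    hw hwR w₁ w₃ w₂
  have t₂ := h.two_le_of_path hR hk hRS h₂ h₄ h₃ hR₂ hR₄ hR₃ z₂ z₄ z₃ n₂₃ n₃₄.symm n₂₄ d₂₃ d₃₄ d₂₄
    hw hwR w₂ w₄ w₃
  have hnn := h.nonneg_of_notMem hRS hw hwR
  have e0 : 0 ≤ ∑ u ∈ R, d s(w, u) := Finset.sum_nonneg hnn
  have q₁ := h.nonneg hw h₁ w₁
  have q₂ := h.nonneg hw h₂ w₂
  have q₃ := h.nonneg hw h₃ w₃
  have q₄ := h.nonneg hw h₄ w₄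
  -- A vertex missing just one vertex of `R` and one of the path extends a zero clique.
  have hclique : ∀ {x y : V}, x ∈ S → y ∈ S → x ∉ R → y ∉ R → x ≠ y → w ≠ x → w ≠ y →
      (∀ u ∈ R, d s(x, u) = 0) → (∀ u ∈ R, d s(y, u) = 0) → d s(x, y) = 0 → d s(w, x) = 0 →
      d s(w, y) = 0 → ∑ u ∈ R, d s(w, u) ≠ 1 := by
    intro x y hx hy hxR hyR hxy hwx hwy hx0 hy0 dxy dwx dwy hsum
    obtain ⟨u, hu, hu1⟩ : ∃ u ∈ R, 1 ≤ d s(w, u) := by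
      by_contra! hcon
      have := Finset.sum_nonpos fun u hu => Int.lt_add_one_iff.1 (hcon u hu)
      lia
    obtain ⟨K, hK, huK, hKcl, hKc⟩ := hR.exists_clique u
    have hyK : y ∉ K := fun hy => hyR (hK hy)
    have hxK : x ∉ insert y K := by
      simp only [Finset.mem_insert, not_or]
      exact ⟨hxy, fun hx => hxR (hK hx)⟩
    have hwK : w ∉ insert x (insert y K) := by
      simp only [Finset.mem_insert, not_or]
      exact ⟨hwx, hwy, fun hw => hwR (hK hw)⟩
    obtain ⟨v, hv, hv1⟩ := h.exists_pos_of_clique (K := insert x (insert y K))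
      (Finset.insert_subset hx (Finset.insert_subset hy (hK.trans hRS)))
      ((hKcl.insert fun v hv => hy0 v (hK hv)).insert (by
        simp only [Finset.mem_insert, forall_eq_or_imp]
        exact ⟨dxy, fun v hv => hx0 v (hK hv)⟩))
      (by rw [Finset.card_insert_of_notMem hxK, Finset.card_insert_of_notMem hyK]; lia) hw hwK
    rcases Finset.mem_insert.1 hv with rfl | hv
    · lia
    rcases Finset.mem_insert.1 hv with rfl | hv
    · lia
    have := add_le_sum_of_nonneg hnn hu (hK hv) fun h => huK (h ▸ hv)
    lia
  have key := one_le_path_weight (Θ := ∑ u ∈ R, θ s(w, u)) hm2 hm3 e0 q₁ q₂ q₃ q₄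
    (by push_cast; exact Finset.sum_le_sum fun u _ => hθ _) (hθ _) (hθ _) (hθ _) (hθ _)
    (hθ2 s(w, p₂)) (hθ2 s(w, p₃)) (by lia) (by lia) ?_ ?_
  · simp only [Fin.sum_univ_succ, Finset.univ_eq_empty, Finset.sum_empty, Matrix.cons_val_zero,
      Matrix.cons_val_succ]
    linarith
  · rintro ⟨he, e₁, e₄, e₂₃⟩
    rcases eq_or_ne (d s(w, p₂)) 0 with e₂ | e₂
    · exact hclique h₁ h₂ hR₁ hR₂ n₁₂ w₁ w₂ z₁ z₂ d₁₂ e₁ e₂ he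
    · exact hclique h₃ h₄ hR₃ hR₄ n₃₄ w₃ w₄ z₃ z₄ d₃₄ (by lia) e₄ he
  · rintro ⟨he, e₁, e₄, e₂, e₃⟩
    refine hcov (h.covered_of_cycle hθ (by linarith) hR hk hRS h₁ h₂ h₃ h₄ hw hR₁ hR₂ hR₃ hR₄ hwR
      z₁ z₂ z₃ z₄ ((Finset.sum_eq_zero_iff_of_nonneg hnn).1 he) n₁₂ n₂₃ n₃₄ w₄.symm w₁ n₁₃ n₂₄
      w₃.symm n₁₄.symm w₂ d₁₂ d₂₃ d₃₄ ?_ e₁ d₁₃ d₂₄ ?_ ?_ e₂)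
    · rw [Sym2.eq_swap]; exact e₄
    · rw [Sym2.eq_swap]; exact e₃
    · rw [Sym2.eq_swap]; exact d₁₄

/-- Weight `1/2` on the `r - 1` pairs and `1/m` on the single vertex `z`. A vertex of deficit at
least two to `z`, or to the pairs together, is covered; the only other option is deficit one to
each. -/
theorem covered_of_sparse (hθ : ∀ e, (d e : ℝ) ≤ θ e) {m : ℝ} (hθ2 : ∀ e, 2 ≤ d e → m ≤ θ e)
    (hm2 : 2 ≤ m) (hm3 : m ≤ 3) (hS : S.Nonempty) (hr : 2 ≤ r)
    (hsum : ∀ X ⊆ S, X.card = 2 * r → (r : ℤ) + 1 ≤ ∑ e ∈ pairs X, d e) :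
    Covered θ S (2 * r + 1) ((r : ℝ) - 1 + 1 / m) := by
  have hm0 : 0 < m := by linarith
  have hinv' : 1 / 3 ≤ 1 / m := one_div_le_one_div_of_le hm0 hm3
  by_contra hcov
  have h : Extendable d S r := .of_not_covered hθ hcov hS hr (by linarith) hsum
  obtain ⟨R, Z, hR, hRS, hZS, hdisj, -, hc, h0⟩ := h.exists_matched (r - 1) (by lia)
  obtain ⟨z, rfl⟩ := Finset.card_eq_one.1 (show Z.card = 1 by lia)
  have hz : z ∈ S := hZS (by simp)
  have hzR : z ∉ R := by simpa using hdisj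
  have hz0 : ∀ x ∈ R, d s(z, x) = 0 := fun x hx => h0 x hx z (by simp)
  have hr' : (((r - 1 : ℕ) : ℕ) : ℝ) = r - 1 := by
    rw [Nat.cast_sub (by lia)]
    simp
  refine hcov (Covered.of_weights (c := 1 / 2) (k := 1) (fun _ => z) (fun _ => 1 / m) hRS
    (fun _ => hz) (by norm_num) (fun _ => by positivity) (Or.inr one_pos)
    (by rw [hR.card]; lia) ?_ ?_)
  · rw [hR.card]
    simp only [Finset.sum_const, Finset.card_univ, Fintype.card_fin, nsmul_eq_mul]
    push_cast
    rw [hr']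
    linarith
  intro v hv hvR hvz
  replace hvz : v ≠ z := hvz 0
  have htwo := h.two_le_of_matched hR (by lia) hRS hz hzR hz0 hv hvR hvz
  have hnn := h.nonneg_of_notMem hRS hv hvR
  have hq := h.nonneg hv hz hvz
  have hΘ : ((∑ x ∈ R, d s(v, x) : ℤ) : ℝ) ≤ ∑ x ∈ R, θ s(v, x) := by
    push_cast
    exact Finset.sum_le_sum fun x _ => hθ _
  have hθz := hθ s(v, z)
  have e0 : 0 ≤ ∑ x ∈ R, d s(v, x) := Finset.sum_nonneg hnn
  simp only [Finset.univ_unique, Finset.sum_const, Finset.card_singleton, one_smul]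
  by_cases hz2 : 2 ≤ d s(v, z)
  · have h1 : 1 / m * m ≤ 1 / m * θ s(v, z) :=
      mul_le_mul_of_nonneg_left (hθ2 _ hz2) (by positivity)
    rw [one_div_mul_cancel hm0.ne'] at h1
    have : (0 : ℝ) ≤ ((∑ x ∈ R, d s(v, x) : ℤ) : ℝ) := by exact_mod_cast e0
    linarith
  by_cases he2 : 2 ≤ ∑ x ∈ R, d s(v, x)
  · have h1 : (2 : ℝ) ≤ ((∑ x ∈ R, d s(v, x) : ℤ) : ℝ) := by exact_mod_cast he2
    have h2 : (0 : ℝ) ≤ 1 / m * θ s(v, z) :=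
      mul_nonneg (by positivity) (le_trans (by exact_mod_cast hq) hθz)
    linarith
  exfalso
  have he1 : ∑ x ∈ R, d s(v, x) = 1 := by lia
  have hz1 : d s(v, z) = 1 := by lia
  obtain ⟨u, hu, hu1⟩ : ∃ u ∈ R, 1 ≤ d s(v, u) := by
    by_contra! hcon
    have := Finset.sum_nonpos fun u hu => Int.lt_add_one_iff.1 (hcon u hu)
    lia
  have hv0 : ∀ x ∈ R, x ≠ u → d s(v, x) = 0 := by
    intro x hx hne
    have := add_le_sum_of_nonneg hnn hx hu hne
    have := hnn x hx
    lia
  have hvu : d s(v, u) = 1 := by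
    have := Finset.single_le_sum hnn hu
    lia
  -- With `y` the partner of `u`, the path `u`, `z`, `y`, `v` has zero deficits, and its three
  -- non-consecutive pairs have deficit one.
  obtain ⟨j, y, R', hj, rfl, hR', huR', hyR', huy, duy, hu0, hy0⟩ := hR.exists_pair hu
  simp only [Finset.mem_insert, not_or, forall_eq_or_imp] at hzR hvR hz0
  rw [Finset.insert_subset_iff, Finset.insert_subset_iff] at hRS
  refine hcov (h.covered_of_path hθ hθ2 hm2 hm3 hR' (by lia) hRS.2.2 hRS.1 hz hRS.2.1 hv
    huR' hzR.2.2 hyR' hvR.2.2 hu0 hz0.2.2 hy0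
    (fun x hx => hv0 x (by simp [hx]) fun h => huR' (h ▸ hx))
    (Ne.symm hzR.1) hzR.2.1 (Ne.symm hvR.2.1) huy hvz.symm (Ne.symm hvR.1) ?_ hz0.2.1 ?_ duy ?_ ?_)
  · rw [Sym2.eq_swap]; exact hz0.1
  · rw [Sym2.eq_swap]; exact hv0 y (by simp) huy.symm
  · rw [Sym2.eq_swap]; exact hz1
  · rw [Sym2.eq_swap]; exact hvu

end Cases

/-! ### Logarithmic losses and the Turán number. -/

section Constants

/-- The logarithmic loss of a pair of multiplicity `a`, compared with multiplicity `a + 1`. -/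
noncomputable def lossOne (a : ℕ) : ℝ := Real.log (a + 1) - Real.log a

/-- The logarithmic loss of a pair of multiplicity `a - 1`, compared with multiplicity `a + 1`. -/
noncomputable def lossTwo (a : ℕ) : ℝ := Real.log (a + 1) - Real.log (a - 1)

/-- The logarithm of the extremal density. -/
noncomputable def logDensity (a r : ℕ) : ℝ :=
  Real.log (a + 1) - lossOne a / ((r : ℝ) - 1 + 1 / (lossTwo a / lossOne a))

variable {a : ℕ}

theorem lossOne_pos (ha : 2 ≤ a) : 0 < lossOne a := by
  have : (2 : ℝ) ≤ a := by exact_mod_cast ha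
  exact sub_pos.2 (Real.log_lt_log (by linarith) (by linarith))

/-- Concavity of the logarithm, in the form of Bernoulli's inequality on either side of `a + 1`. -/
theorem deficit_mul_lossOne_le (ha : 2 ≤ a) {w : ℕ} (hw : 1 ≤ w) :
    ((a : ℝ) + 1 - w) * lossOne a ≤ Real.log (a + 1) - Real.log w := by
  have ha' : (2 : ℝ) ≤ a := by exact_mod_cast ha
  have hw' : (1 : ℝ) ≤ w := by exact_mod_cast hw
  unfold lossOne
  rcases le_total w (a + 1) with h | h
  · obtain ⟨k, hk⟩ := Nat.exists_eq_add_of_le h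
    have hk' : (a : ℝ) + 1 = w + k := by exact_mod_cast hk
    have hb := one_add_mul_le_pow (a := -1 / ((a : ℝ) + 1))
      (by rw [le_div_iff₀ (by linarith)]; linarith) k
    have e1 : 1 + (k : ℝ) * (-1 / ((a : ℝ) + 1)) = w / (a + 1) := by
      field_simp
      linarith
    have e2 : 1 + -1 / ((a : ℝ) + 1) = a / (a + 1) := by
      field_simp
      ring
    rw [e1, e2] at hb
    have := Real.log_le_log (by positivity) hb
    rw [Real.log_pow, Real.log_div (by linarith) (by linarith),
      Real.log_div (by linarith) (by linarith)] at this
    have hk2 : (a : ℝ) + 1 - w = k := by linarith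
    rw [hk2]
    linarith
  · obtain ⟨k, hk⟩ := Nat.exists_eq_add_of_le h
    have hk' : (w : ℝ) = a + 1 + k := by exact_mod_cast hk
    have hb := one_add_mul_le_pow (a := 1 / (a : ℝ))
      (by have : (0 : ℝ) ≤ 1 / a := by positivity
          linarith) k
    have e2 : 1 + 1 / (a : ℝ) = (a + 1) / a := by
      field_simp
    have e1 : (w : ℝ) / (a + 1) ≤ 1 + (k : ℝ) * (1 / (a : ℝ)) := by
      rw [hk', add_div, div_self (by linarith), mul_one_div]
      gcongr
      linarith
    rw [e2] at hb
    have := Real.log_le_log (by positivity) (e1.trans hb)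
    rw [Real.log_pow, Real.log_div (by linarith) (by linarith),
      Real.log_div (by linarith) (by linarith)] at this
    have hk2 : (a : ℝ) + 1 - w = -k := by linarith
    rw [hk2]
    linarith

theorem two_le_lossRatio (ha : 2 ≤ a) : 2 ≤ lossTwo a / lossOne a := by
  rw [le_div_iff₀ (lossOne_pos ha)]
  have := deficit_mul_lossOne_le ha (w := a - 1) (by lia)
  rw [Nat.cast_sub (by lia)] at this
  unfold lossTwo
  push_cast at this
  linarith

theorem lossRatio_le_three (ha : 2 ≤ a) : lossTwo a / lossOne a ≤ 3 := by
  have ha' : (2 : ℝ) ≤ a := by exact_mod_cast ha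
  rw [div_le_iff₀ (lossOne_pos ha)]
  have h1 : ((a : ℝ) + 1) * a ^ 3 ≤ (a + 1) ^ 3 * (a - 1) := by
    nlinarith [mul_nonneg (show (0 : ℝ) ≤ a + 1 by linarith) (show (0 : ℝ) ≤ a - 2 by linarith)]
  have := Real.log_le_log (by positivity) h1
  rw [Real.log_mul (by linarith) (by positivity), Real.log_mul (by positivity) (by linarith),
    Real.log_pow, Real.log_pow] at this
  unfold lossTwo lossOne
  push_cast at this
  linarith

theorem one_le_totalWeight (ha : 2 ≤ a) {r : ℕ} (hr : 2 ≤ r) :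
    1 ≤ (r : ℝ) - 1 + 1 / (lossTwo a / lossOne a) := by
  have : (2 : ℝ) ≤ r := by exact_mod_cast hr
  have := two_le_lossRatio ha
  have : 0 ≤ 1 / (lossTwo a / lossOne a) := by positivity
  linarith

theorem logDensity_nonneg (ha : 2 ≤ a) {r : ℕ} (hr : 2 ≤ r) : 0 ≤ logDensity a r := by
  have ha' : (2 : ℝ) ≤ a := by exact_mod_cast ha
  have h1 := div_le_self (lossOne_pos ha).le (one_le_totalWeight ha hr)
  have h2 : 0 ≤ Real.log a := Real.log_nonneg (by linarith)
  have h3 : lossOne a = Real.log (a + 1) - Real.log a := rfl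
  unfold logDensity
  linarith

theorem turanNumber_two_mul {r : ℕ} (hr : 2 ≤ r) :
    turanNumber (2 * r) (r + 1) + r = (2 * r).choose 2 := by
  have : Nontrivial (Fin (r + 1)) := Fin.nontrivial_iff_two_le.2 (by lia)
  rw [turanNumber, SimpleGraph.extremalNumber_top, Fintype.card_fin, Nat.add_sub_cancel,
    SimpleGraph.card_edgeFinset_turanGraph, Nat.mul_mod_left]
  obtain ⟨s, rfl⟩ := Nat.exists_eq_add_of_le' hr
  have h1 : 2 * (s + 2) * (2 * (s + 2) - 1) = 2 * ((s + 2) * (2 * s + 3)) := by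
    rw [show 2 * (s + 2) - 1 = 2 * s + 3 by lia]
    ring
  have h2 : ((2 * (s + 2)) ^ 2 - 0 ^ 2) * (s + 2 - 1) = 2 * (s + 2) * (2 * (s + 2) * (s + 1)) := by
    rw [show s + 2 - 1 = s + 1 by lia]
    simp
    ring
  rw [h2, Nat.choose_two_right (2 * (s + 2)), h1, Nat.mul_div_cancel_left _ (by lia),
    Nat.mul_div_cancel_left _ (by lia)]
  simp
  ring

end Constants

/-! ### Upper bound by deleting a vertex of low logarithmic degree. -/

section UpperBound

variable {V : Type*} [DecidableEq V] {a r : ℕ}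

theorem exists_logDegree_le (ha : 2 ≤ a) (hr : 2 ≤ r) (G : Multigraph V) {S : Finset V}
    (hS : S.Nonempty) (hpos : ∀ u ∈ S, ∀ v ∈ S, u ≠ v → 1 ≤ G.w s(u, v))
    (hG : ∀ X ⊆ S, X.card = 2 * r → G.edgeSum X + r + 1 ≤ (a + 1) * (2 * r).choose 2) :
    ∃ Y ⊆ S, Y.card ≤ 2 * r + 1 ∧ ∃ y ∈ Y,
      ∑ v ∈ S \ Y, Real.log (G.w s(v, y)) ≤ logDensity a r * (S \ Y).card := by
  have hL := lossOne_pos ha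
  have hT := one_le_totalWeight ha hr
  -- Both functions vanish off the pairs of `S`, so that the comparison `d ≤ θ` holds for every
  -- element of `Sym2 V`.
  obtain ⟨d, hd⟩ : ∃ d : Sym2 V → ℤ,
      ∀ e, d e = if e ∈ pairs S then (a : ℤ) + 1 - G.w e else 0 := ⟨_, fun _ => rfl⟩
  obtain ⟨θ, hθ⟩ : ∃ θ : Sym2 V → ℝ, ∀ e, θ e =
      if e ∈ pairs S then (Real.log (a + 1) - Real.log (G.w e)) / lossOne a else 0 :=
    ⟨_, fun _ => rfl⟩
  have hw : ∀ e ∈ pairs S, 1 ≤ G.w e := by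
    intro e he
    induction e using Sym2.ind with
    | _ u v =>
      obtain ⟨⟨hu, hv⟩, hne⟩ := mk_mem_pairs.1 he
      exact hpos u hu v hv hne
  have hcov : Covered θ S (2 * r + 1) ((r : ℝ) - 1 + 1 / (lossTwo a / lossOne a)) := by
    refine covered_of_sparse (d := d) ?_ ?_ (two_le_lossRatio ha) (lossRatio_le_three ha) hS hr ?_
    · intro e
      rw [hd, hθ]
      split_ifs with he
      · rw [le_div_iff₀ hL]
        push_cast
        exact deficit_mul_lossOne_le ha (hw e he)
      · simp
    · intro e h2
      rw [hd] at h2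
      rw [hθ]
      split_ifs at h2 ⊢ with he
      · refine div_le_div_of_nonneg_right (sub_le_sub_left (Real.log_le_log ?_ ?_) _) hL.le
        · exact_mod_cast hw e he
        · have : (G.w e : ℤ) ≤ (a : ℤ) - 1 := by lia
          exact_mod_cast this
      · lia
    · intro X hX hc
      have h1 : ∑ e ∈ pairs X, d e = ∑ e ∈ pairs X, ((a : ℤ) + 1 - G.w e) := by
        refine Finset.sum_congr rfl fun e he => ?_
        rw [hd, if_pos]
        induction e using Sym2.ind with
        | _ u v =>
          obtain ⟨⟨hu, hv⟩, hne⟩ := mk_mem_pairs.1 he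
          exact mk_mem_pairs.2 ⟨⟨hX hu, hX hv⟩, hne⟩
      have h2 := hG X hX hc
      rw [Multigraph.edgeSum] at h2
      rw [h1, Finset.sum_sub_distrib, Finset.sum_const, card_pairs, hc, nsmul_eq_mul]
      zify at h2
      rw [mul_comm]
      lia
  obtain ⟨Y, hYS, hYne, hYc, ν, hν, hνT, hcover⟩ := hcov
  refine ⟨Y, hYS, hYc, ?_⟩
  by_contra! hcon
  rcases (S \ Y).eq_empty_or_nonempty with hE | ⟨v₀, hv₀⟩
  · obtain ⟨y, hy⟩ := hYne
    have := hcon y hy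
    simp [hE] at this
  have hn : (0 : ℝ) < (S \ Y).card := by exact_mod_cast Finset.card_pos.2 ⟨v₀, hv₀⟩
  obtain ⟨y₀, hy₀, hνy₀⟩ : ∃ y ∈ Y, 0 < ν y := by
    by_contra! h0
    rw [Finset.mem_sdiff] at hv₀
    have := hcover v₀ hv₀.1 hv₀.2
    rw [Finset.sum_eq_zero fun y hy => by rw [le_antisymm (h0 y hy) (hν y hy), zero_mul]] at this
    linarith
  have h1 : ∑ y ∈ Y, ν y * (logDensity a r * (S \ Y).card) <
      ∑ y ∈ Y, ν y * ∑ v ∈ S \ Y, Real.log (G.w s(v, y)) :=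
    Finset.sum_lt_sum (fun y hy => mul_le_mul_of_nonneg_left (hcon y hy).le (hν y hy))
      ⟨y₀, hy₀, mul_lt_mul_of_pos_left (hcon y₀ hy₀) hνy₀⟩
  have h2 : ∑ y ∈ Y, ν y * ∑ v ∈ S \ Y, Real.log (G.w s(v, y)) ≤
      (S \ Y).card * ((∑ y ∈ Y, ν y) * Real.log (a + 1) - lossOne a) := by
    simp_rw [Finset.mul_sum]
    rw [Finset.sum_comm, ← nsmul_eq_mul]
    refine Finset.sum_le_card_nsmul _ _ _ fun v hv => ?_
    rw [Finset.mem_sdiff] at hv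
    have h3 : ∀ y ∈ Y, ν y * Real.log (G.w s(v, y)) =
        ν y * Real.log (a + 1) - lossOne a * (ν y * θ s(v, y)) := by
      intro y hy
      rw [hθ, if_pos (mk_mem_pairs.2 ⟨⟨hv.1, hYS hy⟩, fun h => hv.2 (h ▸ hy)⟩)]
      field_simp
      ring
    rw [Finset.sum_congr rfl h3, Finset.sum_sub_distrib, ← Finset.mul_sum, ← Finset.sum_mul]
    have := mul_le_mul_of_nonneg_left (hcover v hv.1 hv.2) hL.le
    linarith
  rw [← Finset.sum_mul] at h1
  have h3 : (∑ y ∈ Y, ν y) * logDensity a r < (∑ y ∈ Y, ν y) * Real.log (a + 1) - lossOne a := by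
    refine lt_of_mul_lt_mul_left ?_ hn.le
    linarith
  -- The loss per unit of weight is at least `lossOne a / T`, because the total weight is at most
  -- `T`.
  have h4 : (∑ y ∈ Y, ν y) * (lossOne a / ((r : ℝ) - 1 + 1 / (lossTwo a / lossOne a))) ≤
      lossOne a := by
    rw [mul_div_assoc', div_le_iff₀ (by linarith), mul_comm]
    exact mul_le_mul_of_nonneg_left hνT hL.le
  unfold logDensity at h3
  linarith

/-- Each deletion pays the density for the pairs leaving `Y` and at most `(2r + 1) B` for those
inside `Y`. -/
theorem sum_log_le (ha : 2 ≤ a) (hr : 2 ≤ r) (G : Multigraph V) {B : ℝ} (hB : 0 ≤ B)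
    (S : Finset V) (hpos : ∀ u ∈ S, ∀ v ∈ S, u ≠ v → 1 ≤ G.w s(u, v))
    (hle : ∀ u ∈ S, ∀ v ∈ S, u ≠ v → Real.log (G.w s(u, v)) ≤ B)
    (hG : ∀ X ⊆ S, X.card = 2 * r → G.edgeSum X + r + 1 ≤ (a + 1) * (2 * r).choose 2) :
    ∑ e ∈ pairs S, Real.log (G.w e) ≤
      logDensity a r * (S.card.choose 2 : ℕ) + (2 * r + 1) * B * S.card := by
  induction S using Finset.strongInduction with
  | H S ih =>
    rcases S.eq_empty_or_nonempty with rfl | hS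
    · simp [pairs]
    obtain ⟨Y, hYS, hYc, y, hy, hdeg⟩ := exists_logDegree_le ha hr G hS hpos hG
    have hyS := hYS hy
    have hsub := Finset.erase_subset y S
    have ih' := ih (S.erase y) (Finset.erase_ssubset hyS)
      (fun u hu v hv => hpos u (hsub hu) v (hsub hv))
      (fun u hu v hv => hle u (hsub hu) v (hsub hv)) (fun X hX => hG X (hX.trans hsub))
    have hins := sum_pairs_insert (fun e => Real.log (G.w e)) (Finset.notMem_erase y S)
    rw [Finset.insert_erase hyS] at hins
    have hcard := Finset.card_erase_add_one hyS
    have hsplit : ∑ x ∈ S.erase y, Real.log (G.w s(y, x)) =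
        ∑ x ∈ S \ Y, Real.log (G.w s(x, y)) + ∑ x ∈ Y.erase y, Real.log (G.w s(x, y)) := by
      rw [← Finset.sum_union (by
        rw [Finset.disjoint_left]
        intro x hx hx'
        exact (Finset.mem_sdiff.1 hx).2 (Finset.mem_of_mem_erase hx'))]
      refine Finset.sum_congr ?_ fun x _ => by rw [Sym2.eq_swap]
      ext x
      have := @hYS x
      simp only [Finset.mem_erase, Finset.mem_union, Finset.mem_sdiff]
      by_cases hx : x = y
      · simp [hx, hy]
      · tauto
    have hin : ∑ x ∈ Y.erase y, Real.log (G.w s(x, y)) ≤ (2 * r + 1) * B := by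
      calc ∑ x ∈ Y.erase y, Real.log (G.w s(x, y)) ≤ (Y.erase y).card • B := by
            refine Finset.sum_le_card_nsmul _ _ _ fun x hx => ?_
            obtain ⟨hne, hx⟩ := Finset.mem_erase.1 hx
            exact hle x (hYS hx) y hyS hne
        _ ≤ (2 * r + 1) * B := by
            rw [nsmul_eq_mul]
            refine mul_le_mul_of_nonneg_right ?_ hB
            exact_mod_cast (Finset.card_erase_le).trans hYc
    have hout : logDensity a r * ((S \ Y).card : ℝ) ≤ logDensity a r * ((S.erase y).card : ℝ) := by
      refine mul_le_mul_of_nonneg_left ?_ (logDensity_nonneg ha hr)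
      exact_mod_cast Finset.card_le_card fun x hx => by
        obtain ⟨hxS, hxY⟩ := Finset.mem_sdiff.1 hx
        exact Finset.mem_erase.2 ⟨fun h => hxY (h ▸ hy), hxS⟩
    have hchoose : S.card.choose 2 = (S.erase y).card + (S.erase y).card.choose 2 := by
      rw [← hcard, Nat.choose_succ_succ' _ 1, Nat.choose_one_right]
    rw [hins, hsplit, hchoose, ← hcard]
    push_cast
    nlinarith

theorem exPi_le (ha : 2 ≤ a) (hr : 2 ≤ r) {n q : ℕ} (hn : 2 * r ≤ n)
    (hq : q + r + 1 = (a + 1) * (2 * r).choose 2) :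
    (exPi n (2 * r) q : ℝ) ≤ Real.exp (logDensity a r * (n.choose 2 : ℕ) +
      (2 * r + 1) * Real.log (q + 1) * n) := by
  obtain ⟨G, hG, hprod⟩ := (isGreatest_exPi q (by lia : 2 ≤ 2 * r) hn).1
  rw [← hprod, Multigraph.edgeProd]
  by_cases h0 : ∃ e ∈ pairs (Finset.univ : Finset (Fin n)), G.w e = 0
  · obtain ⟨e, he, h0⟩ := h0
    rw [Finset.prod_eq_zero he h0]
    simpa using (Real.exp_pos _).le
  push Not at h0
  have hpos : ∀ e ∈ pairs (Finset.univ : Finset (Fin n)), (0 : ℝ) < G.w e := fun e he => by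
    exact_mod_cast Nat.pos_of_ne_zero (h0 e he)
  have hle : ∀ u v : Fin n, u ≠ v → G.w s(u, v) ≤ q := by
    intro u v huv
    obtain ⟨X, hX, hc⟩ := Finset.exists_superset_card_eq (s := ({u, v} : Finset (Fin n)))
      (n := 2 * r) (by rw [Finset.card_pair huv]; lia) (by simpa using hn)
    exact (Finset.single_le_sum (f := G.w) (fun _ _ => Nat.zero_le _)
      (mk_mem_pairs.2 ⟨⟨hX (by simp), hX (by simp)⟩, huv⟩)).trans (hG X hc)
  push_cast
  rw [← Real.exp_log (Finset.prod_pos hpos), Real.log_prod fun e he => (hpos e he).ne']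
  refine Real.exp_le_exp.2 ?_
  have hq0 : (0 : ℝ) ≤ q := Nat.cast_nonneg q
  have := sum_log_le ha hr G (Real.log_nonneg (by linarith : (1 : ℝ) ≤ q + 1)) Finset.univ
    (fun u _ v _ huv => Nat.pos_of_ne_zero (h0 _ (mk_mem_pairs.2 ⟨⟨by simp, by simp⟩, huv⟩)))
    (fun u _ v _ huv => Real.log_le_log
      (hpos _ (mk_mem_pairs.2 ⟨⟨by simp, by simp⟩, huv⟩)) (by
        have : (G.w s(u, v) : ℝ) ≤ q := by exact_mod_cast hle u v huv
        linarith))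
    (fun X _ hc => by have := hG X hc; lia)
  simpa using this

end UpperBound

/-! ### Lower bound by the class construction. -/

section LowerBound

/-- The multiplicity between class `i` and class `j` in the extremal construction. -/
def classMult (a i j : ℕ) : ℕ := if i = j then if i = 0 then a - 1 else a else a + 1

theorem classMult_comm (a i j : ℕ) : classMult a i j = classMult a j i := by
  unfold classMult
  split_ifs <;> lia

theorem classMult_pos {a : ℕ} (ha : 2 ≤ a) (i j : ℕ) : 0 < classMult a i j := by
  unfold classMult
  split_ifs <;> lia

/-- The relative size of class `i` in the extremal construction. -/
noncomputable def classWeight (a r i : ℕ) : ℝ :=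
  lossOne a / ((r : ℝ) - 1 + 1 / (lossTwo a / lossOne a)) /
    (if i = 0 then lossTwo a else lossOne a)

variable {V : Type*} [DecidableEq V] {a r : ℕ}

/-- The multigraph with vertex classes `κ`. -/
def classGraph (a : ℕ) (κ : V → ℕ) : Multigraph V where
  w := Sym2.lift ⟨fun u v => if u = v then 0 else classMult a (κ u) (κ v), fun u v => by
    simp only [classMult_comm a (κ u), @eq_comm _ u]⟩
  w_diag v := by simp

theorem classGraph_w (a : ℕ) (κ : V → ℕ) {u v : V} (h : u ≠ v) :
    (classGraph a κ).w s(u, v) = classMult a (κ u) (κ v) := by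
  simp [classGraph, h]

theorem lossTwo_pos (ha : 2 ≤ a) : 0 < lossTwo a := by
  have h1 := two_le_lossRatio ha
  have h2 := lossOne_pos ha
  rw [le_div_iff₀ h2] at h1
  linarith

theorem classWeight_nonneg (ha : 2 ≤ a) (hr : 2 ≤ r) (i : ℕ) : 0 ≤ classWeight a r i := by
  have h1 := lossOne_pos ha
  have h2 := lossTwo_pos ha
  have h3 := one_le_totalWeight ha hr
  unfold classWeight
  refine div_nonneg (div_nonneg h1.le (by linarith)) ?_
  split_ifs <;> linarith

theorem sum_classWeight (ha : 2 ≤ a) (hr : 2 ≤ r) : ∑ i ∈ range r, classWeight a r i = 1 := by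
  have h1 := lossOne_pos ha
  have h2 := lossTwo_pos ha
  have h3 := one_le_totalWeight ha hr
  obtain ⟨k, rfl⟩ := Nat.exists_eq_add_of_le' (show 1 ≤ r by lia)
  rw [one_div_div] at h3
  simp only [classWeight, Finset.sum_range_succ', Nat.add_eq_zero_iff, one_ne_zero, and_false,
    if_false, if_true, Finset.sum_const, Finset.card_range, nsmul_eq_mul, one_div_div]
  have h4 : ((k + 1 : ℕ) : ℝ) - 1 + lossOne a / lossTwo a ≠ 0 := by linarith
  push_cast at h4 ⊢
  have h5 : (k : ℝ) * lossTwo a + lossOne a ≠ 0 := by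
    intro h
    apply h4
    field_simp
    linarith
  have h6 : (k : ℝ) + 1 - 1 + lossOne a / lossTwo a = (k * lossTwo a + lossOne a) / lossTwo a := by
    field_simp
    ring
  rw [h6]
  field_simp

/-- Class weight times inner loss is the same for all classes, so the weighted logarithmic degree
does not depend on `j`. -/
theorem sum_classWeight_mul_log (ha : 2 ≤ a) (hr : 2 ≤ r) {j : ℕ} (hj : j < r) :
    ∑ i ∈ range r, classWeight a r i * Real.log (classMult a i j) = logDensity a r := by
  have h1 := lossOne_pos ha
  have h2 := lossTwo_pos ha
  have key : ∀ i ∈ range r, classWeight a r i * Real.log (classMult a i j) =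
      classWeight a r i * Real.log (a + 1) -
        if i = j then lossOne a / ((r : ℝ) - 1 + 1 / (lossTwo a / lossOne a)) else 0 := by
    intro i _
    unfold classMult
    split_ifs with hij hi
    · rw [Nat.cast_sub (by lia), classWeight, if_pos hi]
      have : Real.log ((a : ℝ) - (1 : ℕ)) = Real.log (a + 1) - lossTwo a := by
        simp [lossTwo]
      rw [this, mul_sub, div_mul_cancel₀ _ h2.ne']
    · rw [classWeight, if_neg hi]
      have : Real.log (a : ℝ) = Real.log (a + 1) - lossOne a := by
        simp [lossOne]
      rw [this, mul_sub, div_mul_cancel₀ _ h1.ne']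
    · push_cast
      ring
  rw [Finset.sum_congr rfl key, Finset.sum_sub_distrib, ← Finset.sum_mul, sum_classWeight ha hr,
    Finset.sum_ite_eq' (range r) j, if_pos (Finset.mem_range.2 hj), one_mul]
  rfl

/-- Each new vertex joins a class doing at least as well as the weighted average. This avoids
rounding class sizes and leaves no error term. -/
theorem exists_classes (ha : 2 ≤ a) (hr : 2 ≤ r) (S : Finset V) :
    ∃ κ : V → ℕ, (∀ v, κ v < r) ∧ logDensity a r * (S.card.choose 2 : ℕ) ≤
      ∑ e ∈ pairs S, Real.log ((classGraph a κ).w e) := by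
  induction S using Finset.induction_on with
  | empty => exact ⟨fun _ => 0, fun _ => by lia, by simp [pairs]⟩
  | insert v S hv ih =>
    obtain ⟨κ, hκ, hle⟩ := ih
    obtain ⟨i, hi, hsum⟩ : ∃ i < r, logDensity a r * S.card ≤
        ∑ x ∈ S, Real.log (classMult a i (κ x)) := by
      by_contra! hcon
      have h1 : ∑ i ∈ range r, classWeight a r i * ∑ x ∈ S, Real.log (classMult a i (κ x)) =
          logDensity a r * S.card := by
        simp_rw [Finset.mul_sum]
        rw [Finset.sum_comm, Finset.sum_congr rfl fun x _ =>
          sum_classWeight_mul_log ha hr (hκ x), Finset.sum_const, nsmul_eq_mul, mul_comm]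
      have h2 : ∑ i ∈ range r, classWeight a r i * ∑ x ∈ S, Real.log (classMult a i (κ x)) <
          ∑ i ∈ range r, classWeight a r i * (logDensity a r * S.card) := by
        obtain ⟨i, hi, h0⟩ : ∃ i ∈ range r, 0 < classWeight a r i := by
          by_contra! h0
          have := sum_classWeight ha hr
          have := Finset.sum_nonpos h0
          linarith
        refine Finset.sum_lt_sum (fun i hi => mul_le_mul_of_nonneg_left
          (hcon i (Finset.mem_range.1 hi)).le (classWeight_nonneg ha hr i))
          ⟨i, hi, mul_lt_mul_of_pos_left (hcon i (Finset.mem_range.1 hi)) h0⟩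
      rw [h1, ← Finset.sum_mul, sum_classWeight ha hr, one_mul] at h2
      exact lt_irrefl _ h2
    refine ⟨Function.update κ v i, fun u => ?_, ?_⟩
    · rcases eq_or_ne u v with rfl | h
      · simpa using hi
      · simpa [h] using hκ u
    · rw [sum_pairs_insert _ hv, Finset.card_insert_of_notMem hv, Nat.choose_succ_succ' _ 1,
        Nat.choose_one_right]
      have h1 : ∑ e ∈ pairs S, Real.log ((classGraph a (Function.update κ v i)).w e) =
          ∑ e ∈ pairs S, Real.log ((classGraph a κ).w e) := by
        refine Finset.sum_congr rfl fun e he => ?_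
        induction e using Sym2.ind with
        | _ x y =>
          obtain ⟨⟨hx, hy⟩, hne⟩ := mk_mem_pairs.1 he
          rw [classGraph_w _ _ hne, classGraph_w _ _ hne,
            Function.update_of_ne (ne_of_mem_of_not_mem hx hv),
            Function.update_of_ne (ne_of_mem_of_not_mem hy hv)]
      have h2 : ∑ x ∈ S, Real.log ((classGraph a (Function.update κ v i)).w s(v, x)) =
          ∑ x ∈ S, Real.log (classMult a i (κ x)) := by
        refine Finset.sum_congr rfl fun x hx => ?_
        have hne : x ≠ v := fun h => hv (h ▸ hx)
        rw [classGraph_w _ _ hne.symm, Function.update_self, Function.update_of_ne hne]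
      rw [h1, h2]
      push_cast
      linarith

theorem edgeSum_classGraph (ha : 1 ≤ a) {κ : V → ℕ} (hκ : ∀ v, κ v < r) (X : Finset V) :
    (classGraph a κ).edgeSum X + ∑ i ∈ range r,
      (if i = 0 then 2 else 1) * (X.filter fun v => κ v = i).card.choose 2 =
      (a + 1) * X.card.choose 2 := by
  induction X using Finset.induction_on with
  | empty => simp [Multigraph.edgeSum, pairs]
  | insert v X hv ih =>
    rw [Multigraph.edgeSum, sum_pairs_insert _ hv, ← Multigraph.edgeSum,
      Finset.card_insert_of_notMem hv, Nat.choose_succ_succ' _ 1, Nat.choose_one_right, mul_add,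
      ← ih]
    have h1 : ∀ i ∈ range r, (if i = 0 then 2 else 1) *
        ((insert v X).filter fun u => κ u = i).card.choose 2 =
        (if i = 0 then 2 else 1) * (X.filter fun u => κ u = i).card.choose 2 +
        if i = κ v then (if i = 0 then 2 else 1) * (X.filter fun u => κ u = κ v).card else 0 := by
      intro i _
      by_cases h : i = κ v
      · subst h
        rw [Finset.filter_insert, if_pos rfl, Finset.card_insert_of_notMem (by simp [hv]),
          Nat.choose_succ_succ' _ 1, Nat.choose_one_right, if_pos rfl]
        ring
      · rw [Finset.filter_insert, if_neg (Ne.symm h), if_neg h, add_zero]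
    have h2 : ∑ x ∈ X, (classGraph a κ).w s(v, x) +
        (if κ v = 0 then 2 else 1) * (X.filter fun u => κ u = κ v).card = (a + 1) * X.card := by
      rw [Finset.card_filter, Finset.mul_sum, ← Finset.sum_add_distrib, mul_comm, ← smul_eq_mul,
        ← Finset.sum_const]
      refine Finset.sum_congr rfl fun x hx => ?_
      rw [classGraph_w _ _ (ne_of_mem_of_not_mem hx hv).symm, classMult]
      split_ifs <;> lia
    rw [Finset.sum_congr rfl h1, Finset.sum_add_distrib, Finset.sum_ite_eq' (range r) (κ v),
      if_pos (Finset.mem_range.2 (hκ v)), ← h2]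
    ring

theorem sub_one_le_choose_two (m : ℕ) : (m : ℤ) - 1 ≤ (m.choose 2 : ℕ) := by
  induction m with
  | zero => simp
  | succ m ih =>
    rw [Nat.choose_succ_succ' _ 1, Nat.choose_one_right]
    push_cast
    have : (0 : ℤ) ≤ (m.choose 2 : ℕ) := Int.natCast_nonneg _
    lia

theorem two_mul_sub_three_le_choose_two (m : ℕ) : 2 * (m : ℤ) - 3 ≤ (m.choose 2 : ℕ) := by
  induction m with
  | zero => simp
  | succ m ih =>
    rw [Nat.choose_succ_succ' _ 1, Nat.choose_one_right]
    push_cast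
    have := sub_one_le_choose_two m
    rcases Nat.lt_or_ge m 2 with h | h
    · interval_cases m <;> simp
    · lia

/-- Bound `(m i).choose 2` below by linear functions: `m - 1` when class `0` has at least two
vertices, and `2m - 3` on the other classes when it has fewer. -/
theorem le_sum_choose_two {k : ℕ} {m : ℕ → ℕ} (hm : ∑ i ∈ range (k + 1), m i = 2 * (k + 1)) :
    k + 2 ≤ ∑ i ∈ range (k + 1), (if i = 0 then 2 else 1) * (m i).choose 2 := by
  rw [Finset.sum_range_succ'] at hm ⊢
  simp only [Nat.add_eq_zero_iff, one_ne_zero, and_false, if_false, if_true, one_mul]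
  have h1 : ∑ i ∈ range k, ((m (i + 1) : ℤ) - 1) ≤ ∑ i ∈ range k, ((m (i + 1)).choose 2 : ℤ) :=
    Finset.sum_le_sum fun i _ => sub_one_le_choose_two _
  have h2 : ∑ i ∈ range k, (2 * (m (i + 1) : ℤ) - 3) ≤
      ∑ i ∈ range k, ((m (i + 1)).choose 2 : ℤ) :=
    Finset.sum_le_sum fun i _ => two_mul_sub_three_le_choose_two _
  rw [Finset.sum_sub_distrib] at h1 h2
  rw [← Finset.mul_sum] at h2
  simp only [Finset.sum_const, Finset.card_range, nsmul_eq_mul] at h1 h2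
  have h3 := sub_one_le_choose_two (m 0)
  zify at hm ⊢
  rcases Nat.lt_or_ge (m 0) 2 with h | h
  · interval_cases m 0 <;> simp at * <;> lia
  · lia

theorem isSQ_classGraph (ha : 1 ≤ a) (hr : 2 ≤ r) {κ : V → ℕ} (hκ : ∀ v, κ v < r) {q : ℕ}
    (hq : q + r + 1 = (a + 1) * (2 * r).choose 2) : (classGraph a κ).IsSQ (2 * r) q := by
  intro X hX
  have h1 := edgeSum_classGraph ha hκ X
  obtain ⟨k, rfl⟩ := Nat.exists_eq_add_of_le' (show 1 ≤ r by lia)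
  have h2 : ∑ i ∈ range (k + 1), (X.filter fun v => κ v = i).card = 2 * (k + 1) := by
    rw [← hX]
    exact (Finset.card_eq_sum_card_fiberwise fun v _ => by simpa using hκ v).symm
  have h3 := le_sum_choose_two h2
  rw [hX] at h1
  lia

theorem le_exPi (ha : 2 ≤ a) (hr : 2 ≤ r) {n q : ℕ} (hn : 2 * r ≤ n)
    (hq : q + r + 1 = (a + 1) * (2 * r).choose 2) :
    Real.exp (logDensity a r * (n.choose 2 : ℕ)) ≤ exPi n (2 * r) q := by
  obtain ⟨κ, hκ, hle⟩ := exists_classes ha hr (Finset.univ : Finset (Fin n))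
  have hP : (classGraph a κ).edgeProd ≤ exPi n (2 * r) q :=
    (isGreatest_exPi q (by lia : 2 ≤ 2 * r) hn).2 ⟨_, isSQ_classGraph (by lia) hr hκ hq, rfl⟩
  refine le_trans ?_ (Nat.cast_le.2 hP)
  have hpos : ∀ e ∈ pairs (Finset.univ : Finset (Fin n)), (0 : ℝ) < (classGraph a κ).w e := by
    intro e he
    induction e using Sym2.ind with
    | _ u v =>
      rw [classGraph_w _ _ (mk_mem_pairs.1 he).2]
      exact_mod_cast classMult_pos ha _ _
  rw [Multigraph.edgeProd]
  push_cast
  rw [← Real.exp_log (Finset.prod_pos hpos), Real.log_prod fun e he => (hpos e he).ne']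
  refine Real.exp_le_exp.2 ?_
  simpa using hle

end LowerBound

/-! ### The closed form and the limit. -/

section Limit

variable {a r : ℕ}

theorem exp_logDensity (ha : 2 ≤ a) (hr : 2 ≤ r) :
    (a : ℝ) ^ ((1 - xStar a r) / ((r : ℝ) - 1)) *
        ((a : ℝ) + 1) ^ (((r : ℝ) - 2 + xStar a r) / ((r : ℝ) - 1)) =
      Real.exp (logDensity a r) := by
  have ha' : (2 : ℝ) ≤ a := by exact_mod_cast ha
  have hr' : (2 : ℝ) ≤ r := by exact_mod_cast hr
  have h1 := lossOne_pos ha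
  have h2 := lossTwo_pos ha
  have hr1 : (r : ℝ) - 1 ≠ 0 := by linarith
  -- This is the weight of class `0` in the construction.
  have hx : xStar a r = lossOne a / ((r - 1) * lossTwo a + lossOne a) := by
    have hpow : (0 : ℝ) < (a - 1) ^ (r - 1) := pow_pos (by linarith) _
    rw [xStar, Real.log_div (by linarith) (by linarith), Real.log_div (by positivity)
      (mul_pos hpow (by linarith)).ne', Real.log_mul hpow.ne' (by linarith), Real.log_pow,
      Real.log_pow, Nat.cast_sub (by lia), ← lossOne]
    congr 1
    unfold lossTwo lossOne
    push_cast
    ring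
  have hD : 0 < ((r : ℝ) - 1) * lossTwo a + lossOne a :=
    add_pos (mul_pos (by linarith) h2) h1
  have hΛ : logDensity a r = Real.log (a + 1) -
      lossOne a * lossTwo a / ((r - 1) * lossTwo a + lossOne a) := by
    have : (r : ℝ) - 1 + 1 / (lossTwo a / lossOne a) =
        ((r - 1) * lossTwo a + lossOne a) / lossTwo a := by
      field_simp
    rw [logDensity, this]
    field_simp
  rw [Real.rpow_def_of_pos (by linarith), Real.rpow_def_of_pos (by linarith), ← Real.exp_add]
  congr 1
  have hla : Real.log a = Real.log (a + 1) - lossOne a := by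
    rw [lossOne, sub_sub_cancel]
  rw [hla, hx, hΛ]
  field_simp
  ring

theorem tendsto_exPi (ha : 2 ≤ a) (hr : 2 ≤ r) {q : ℕ}
    (hq : q + r + 1 = (a + 1) * (2 * r).choose 2) :
    IsExPi (2 * r) q (Real.exp (logDensity a r)) := by
  have hlim : Tendsto (fun n : ℕ => Real.exp (logDensity a r +
      (2 * r + 1) * Real.log (q + 1) * 2 / ((n : ℝ) - 1))) atTop
      (𝓝 (Real.exp (logDensity a r))) := by
    refine (Real.continuous_exp.tendsto _).comp ?_
    have h := (tendsto_const_nhds (x := (2 * r + 1) * Real.log (q + 1) * 2)).div_atTop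
      (tendsto_atTop_add_const_right atTop (-1 : ℝ) tendsto_natCast_atTop_atTop)
    simpa [sub_eq_add_neg] using h.const_add (logDensity a r)
  refine tendsto_of_tendsto_of_tendsto_of_le_of_le' tendsto_const_nhds hlim ?_ ?_ <;>
    filter_upwards [eventually_ge_atTop (2 * r)] with n hn
  all_goals
    have hc : 0 < ((n.choose 2 : ℕ) : ℝ) := by exact_mod_cast Nat.choose_pos (by lia)
    have hinv : 0 ≤ 1 / ((n.choose 2 : ℕ) : ℝ) := by positivity
  · have := Real.rpow_le_rpow (Real.exp_pos _).le (le_exPi ha hr hn hq) hinv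
    rwa [← Real.exp_mul, mul_one_div, mul_div_cancel_right₀ _ hc.ne'] at this
  · have := Real.rpow_le_rpow (Nat.cast_nonneg _) (exPi_le ha hr hn hq) hinv
    have hn2 : (2 : ℝ) ≤ n := by exact_mod_cast (by lia : 2 ≤ n)
    have h1 : (n : ℝ) - 1 ≠ 0 := by linarith
    rw [← Real.exp_mul, mul_one_div, add_div, mul_div_cancel_right₀ _ hc.ne'] at this
    refine this.trans_eq ?_
    rw [Nat.cast_choose_two]
    field_simp

end Limit

end MubayiTerry

theorem theorem1p1 (a r : ℕ) (ha : 2 ≤ a) (hr : 2 ≤ r) :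
    MubayiTerry.IsExPi (2 * r)
      (a * (2 * r).choose 2 + MubayiTerry.turanNumber (2 * r) (r + 1) - 1)
      ((a : ℝ) ^ ((1 - MubayiTerry.xStar a r) / ((r : ℝ) - 1)) *
        ((a : ℝ) + 1) ^ (((r : ℝ) - 2 + MubayiTerry.xStar a r) / ((r : ℝ) - 1))) := by
  rw [MubayiTerry.exp_logDensity ha hr]
  refine MubayiTerry.tendsto_exPi ha hr ?_
  have h1 := MubayiTerry.turanNumber_two_mul hr
  have h2 : 1 ≤ a * (2 * r).choose 2 := Nat.mul_pos (by lia) (Nat.choose_pos (by lia))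
  rw [add_mul]
  lia
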